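/- Let $1<p<3$. For $\omega\ge 0$ and real-valued $u\in H^1(\mathbb{R})$ let $$J_\omega(u)=\frac12\int_{\mathbb{R}}\left(|u'|^2+\omega u^2\right)dr+\frac1{24}\left(\int_{\mathbb{R}}u^2\,dr\right)^3-\frac1{p+1}\int_{\mathbb{R}}|u|^{p+1}\,dr .$$ For $k>0$ let $$w_k(r)=k^{\frac1{p-1}}w_1(\sqrt k\,r),\qquad w_1(r)=\left(\frac{2}{p+1}\cosh^2\left(\frac{p-1}{2}r\right)\right)^{\frac1{1-p}},\qquad m=\int_{\mathbb{R}}w_1^2\,dr .$$ Let $\omega_0=\inf\{\omega\ge 0:\ \min_{H^1(\mathbb{R})}J_\omega=0\}$ and $$\omega_1=\left(\frac{(5-p)m^2}{4(p-1)}\right)^{-\frac{p-1}{2(3-p)}}-\frac{m^2}{4}\left(\frac{(5-p)m^2}{4(p-1)}\right)^{-\frac{5-p}{2(3-p)}} .$$ Then, for every $k>0$, $w_k$ is the unique positive even classical ($C^2$) solution in $H^1(\mathbb{R})$ of $-w''+kw=w^p$; moreover $\omega_0>0$, and for $\omega\ge0$ the functional $J_\omega$ takes a negative value if and only if $\omega<\omega_0$.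 Furthermore: 1. $\omega_0<\omega_1$, and $$\omega_0=\frac{3-p}{3+p}\;3^{\frac{p-1}{2(3-p)}}\;2^{\frac{2}{3-p}}\left(\frac{m^2(3+p)}{p-1}\right)^{-\frac{p-1}{2(3-p)}} .$$ 2. For every $\omega\in(0,\omega_1)$ the equation $k=\omega+\frac14m^2k^{\frac{5-p}{p-1}}$ has exactly two solutions $0<k_1<k_2$, and $J_\omega(w_{k_1})>J_\omega(w_{k_2})$. In particular, for every $\omega\in(0,\omega_0)$ the function $w_{k_2}$ is a global minimizer of $J_\omega$ on $H^1(\mathbb{R})$. -/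

import Mathlib

open MeasureTheory

noncomputable section

namespace GaugedNLS

/-- `g` is a weak (distributional) derivative of `u` on the real line, tested against all
smooth compactly supported functions. -/
def IsWeakDeriv (u g : ℝ → ℝ) : Prop :=
  ∀ φ : ℝ → ℝ, ContDiff ℝ (⊤ : ℕ∞) φ → HasCompactSupport φ →
    ∫ r, u r * deriv φ r = -∫ r, g r * φ r

/-- The Sobolev space `H¹(ℝ)` of real functions: square integrable functions with a square
integrable weak derivative. Its elements are functions, not classes modulo null sets; all the
integrals below depend only on the class. -/
def H1 : Set (ℝ → ℝ) :=
  {u | MemLp u 2 volume ∧ ∃ g : ℝ → ℝ, MemLp g 2 volume ∧ IsWeakDeriv u g}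

open Classical in
/-- A square integrable weak derivative `u'` of `u ∈ H¹(ℝ)` (and `0` if `u` has none). It is
unique up to null sets, see `weakDeriv_ae_eq`. -/
def weakDeriv (u : ℝ → ℝ) : ℝ → ℝ :=
  if h : ∃ g : ℝ → ℝ, MemLp g 2 volume ∧ IsWeakDeriv u g then h.choose else 0

theorem weakDeriv_ae_eq {u g : ℝ → ℝ} (hg : MemLp g 2 volume) (h : IsWeakDeriv u g) :
    weakDeriv u =ᵐ[volume] g := by
  have hex : ∃ g : ℝ → ℝ, MemLp g 2 volume ∧ IsWeakDeriv u g := ⟨g, hg, h⟩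
  have hspec := hex.choose_spec
  have hdef : weakDeriv u = hex.choose := by
    unfold weakDeriv
    rw [dif_pos hex]
  rw [hdef]
  refine ae_eq_of_integral_contDiff_smul_eq
    (hspec.1.locallyIntegrable (by norm_num)) (hg.locallyIntegrable (by norm_num)) ?_
  intro φ hφ hc
  have h1 := hspec.2 φ hφ hc
  have h2 := h φ hφ hc
  simp only [smul_eq_mul, mul_comm (φ _)]
  linarith

/-- The limit functional `J_ω : H¹(ℝ) → ℝ`. -/
def J (p ω : ℝ) (u : ℝ → ℝ) : ℝ :=
  1 / 2 * (∫ r, (|weakDeriv u r| ^ 2 + ω * u r ^ 2))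
    + 1 / 24 * (∫ r, u r ^ 2) ^ 3
    - 1 / (p + 1) * ∫ r, |u r| ^ (p + 1)

/-- The threshold `ω₀`: the smallest `ω ≥ 0` such that `min J_ω = 0` over `H¹(ℝ)`. -/
def omega0 (p : ℝ) : ℝ :=
  sInf {ω : ℝ | 0 ≤ ω ∧ IsLeast (J p ω '' H1) 0}

/-- `v` is a positive radial (that is, even) solution in `H¹(ℝ)` of `-v'' + k v = v ^ p`. -/
structure IsPositiveRadialSolution (p k : ℝ) (v : ℝ → ℝ) : Prop where
  mem_H1 : v ∈ H1
  pos : ∀ r, 0 < v r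
  even : ∀ r, v (-r) = v r
  contDiff : ContDiff ℝ 2 v
  equation : ∀ r, -deriv (deriv v) r + k * v r = v r ^ p

/-- The profile `w₁`. -/
def w1 (p r : ℝ) : ℝ :=
  (2 / (p + 1) * Real.cosh ((p - 1) / 2 * r) ^ 2) ^ (1 / (1 - p))

/-- The profiles `w_k`, obtained from `w₁` by scaling. -/
def w (p k r : ℝ) : ℝ :=
  k ^ (1 / (p - 1)) * w1 p (Real.sqrt k * r)

/-- The mass `m = ∫ w₁²`. -/
def m (p : ℝ) : ℝ := ∫ r, w1 p r ^ 2

/-- The positive roots `k` of `k = ω + (1/4) m² k ^ ((5-p)/(p-1))`. -/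
def roots (p ω : ℝ) : Set ℝ :=
  {k | 0 < k ∧ k = ω + 1 / 4 * m p ^ 2 * k ^ ((5 - p) / (p - 1))}

/-- The value `ω₁`. -/
def omega1 (p : ℝ) : ℝ :=
  ((5 - p) * m p ^ 2 / (4 * (p - 1))) ^ (-((p - 1) / (2 * (3 - p))))
    - m p ^ 2 / 4 * ((5 - p) * m p ^ 2 / (4 * (p - 1))) ^ (-((5 - p) / (2 * (3 - p))))

end GaugedNLS

end

/-!
The functional `J_ω` is minimized first among functions of a given mass, and then over the mass.

For the first step, let `u ∈ H¹(ℝ)` be nonzero, with absolutely continuous representative `v`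
(`IsWeakDeriv.exists_isPrimitive`), and let `A = max |v|`. There is exactly one `k > 0` with
`w_k(0) = A`. With `f(s) = √(k s² - (2 / (p + 1)) |s| ^ (p + 1))`, which is real for `|s| ≤ A`,
Young's inequality gives
`∫ (v'² / 2 + k v² / 2 - |v| ^ (p + 1) / (p + 1)) ≥ ∫ f(v) |v'| ≥ 2 ∫₀ᴬ f`,
since `v` runs from `0` to `± A` and back to `0`. By the first integral `w_k'² = f(w_k)²` both are
equalities for `w_k`, so the right side is `∫ w_k'²` (`exists_action_ge`), which is a multiple of
`k ^ (e + 1)` with `∫ w_k² = m k ^ e`, `e = (5 - p) / (2 (p - 1))`. This multiple is convex in `k`,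
and its tangent line at the `κ` for which `w_κ` has the mass of `u` turns the bound into
`J_ω(w_κ) ≤ J_ω(u)` (`J_eq_zero_or_exists_J_w_le`). No compactness argument or existence theorem
for minimizers is needed.

The second step is calculus for the explicit function `k ↦ J_ω(w_k)` (`J_w_eq_profileEnergy`). Its
derivative is a positive multiple of `ω - k + (m² / 4) k ^ (2 e)`, strictly convex in `k` because
`p < 3` means `2 e > 1`; so it increases up to `k₁`, decreases to `k₂`, and increases again
(`exists_roots_profileEnergy`). It is negative somewhere exactly if `ω` is less than the maximum of
`(e / (e + 1)) k - (m² / 12) k ^ (2 e)`, which is therefore `ω₀` (`omega0_eq`), while `ω₁` is the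
maximum of `k - (m² / 4) k ^ (2 e)`. At the maximum point of the former the two functions agree, and
it is not the maximum point of the latter, whence `ω₀ < ω₁` (`energy_max_lt_omega1`).

Uniqueness of the profile: the energy of a solution in `H¹(ℝ)` is constant and integrable, hence
zero, and then `v ^ (-(p - 1) / 2)` solves a linear equation with solution a multiple of `cosh`
(`IsPositiveRadialSolution.eq_w`).
-/

open Filter Topology Set

namespace GaugedNLS

/-! ### The profiles `w_k` -/

/-- The negative logarithmic derivative `-w_k' / w_k = √k tanh (((p - 1) / 2) √k r)` of the
profile. -/
noncomputable def slope (p k r : ℝ) : ℝ :=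
  Real.sqrt k * Real.tanh ((p - 1) / 2 * (Real.sqrt k * r))

lemma hasDerivAt_tanh (x : ℝ) : HasDerivAt Real.tanh (1 - Real.tanh x ^ 2) x := by
  have hc := (Real.cosh_pos x).ne'
  have h := (Real.hasDerivAt_sinh x).div (Real.hasDerivAt_cosh x) hc
  have h' : HasDerivAt Real.tanh
      ((Real.cosh x * Real.cosh x - Real.sinh x * Real.sinh x) / Real.cosh x ^ 2) x := by
    refine h.congr_of_eventuallyEq (Eventually.of_forall fun y => ?_)
    simp [Real.tanh_eq_sinh_div_cosh]
  convert h' using 1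
  rw [Real.tanh_eq_sinh_div_cosh]
  field_simp

lemma tanh_sq_lt_one (x : ℝ) : Real.tanh x ^ 2 < 1 := by
  have := Real.tanh_lt_one x
  have := Real.neg_one_lt_tanh x
  nlinarith

lemma slope_hasDerivAt (p : ℝ) {k : ℝ} (hk : 0 < k) (r : ℝ) :
    HasDerivAt (slope p k) ((p - 1) / 2 * (k - slope p k r ^ 2)) r := by
  have h1 : HasDerivAt (fun r : ℝ => (p - 1) / 2 * (Real.sqrt k * r))
      ((p - 1) / 2 * (Real.sqrt k * 1)) r :=
    ((hasDerivAt_id r).const_mul _).const_mul _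
  have h2 := ((hasDerivAt_tanh _).comp r h1).const_mul (Real.sqrt k)
  refine h2.congr_deriv ?_
  unfold slope
  have := Real.sq_sqrt hk.le
  linear_combination (p - 1) / 2 * this

lemma slope_sq_lt (p : ℝ) {k : ℝ} (hk : 0 < k) (r : ℝ) : slope p k r ^ 2 < k := by
  unfold slope
  rw [mul_pow, Real.sq_sqrt hk.le]
  have := tanh_sq_lt_one ((p - 1) / 2 * (Real.sqrt k * r))
  nlinarith

lemma slope_neg (p k r : ℝ) : slope p k (-r) = -slope p k r := by
  simp [slope]

lemma slope_nonneg {p : ℝ} (hp : 1 < p) (k : ℝ) {r : ℝ} (hr : 0 ≤ r) : 0 ≤ slope p k r := by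
  unfold slope
  have : 0 ≤ (p - 1) / 2 * (Real.sqrt k * r) :=
    mul_nonneg (by linarith) (mul_nonneg (Real.sqrt_nonneg _) hr)
  refine mul_nonneg (Real.sqrt_nonneg _) ?_
  rw [Real.tanh_eq_sinh_div_cosh]
  exact div_nonneg (Real.sinh_nonneg_iff.2 this) (Real.cosh_pos _).le

lemma continuous_slope (p : ℝ) {k : ℝ} (hk : 0 < k) : Continuous (slope p k) :=
  continuous_iff_continuousAt.2 fun r => (slope_hasDerivAt p hk r).continuousAt

lemma w1_pos {p : ℝ} (hp : 1 < p) (r : ℝ) : 0 < w1 p r := by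
  have := Real.cosh_pos ((p - 1) / 2 * r)
  unfold w1
  exact Real.rpow_pos_of_pos (mul_pos (div_pos two_pos (by linarith)) (by positivity)) _

lemma w_pos {p k : ℝ} (hp : 1 < p) (hk : 0 < k) (r : ℝ) : 0 < w p k r :=
  mul_pos (Real.rpow_pos_of_pos hk _) (w1_pos hp _)

lemma w_neg (p k r : ℝ) : w p k (-r) = w p k r := by
  simp [w, w1]

lemma w1_hasDerivAt {p : ℝ} (hp : 1 < p) (r : ℝ) :
    HasDerivAt (w1 p) (-Real.tanh ((p - 1) / 2 * r) * w1 p r) r := by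
  have hc := Real.cosh_pos ((p - 1) / 2 * r)
  have h0 : 0 < 2 / (p + 1) * Real.cosh ((p - 1) / 2 * r) ^ 2 :=
    mul_pos (div_pos two_pos (by linarith)) (by positivity)
  have h1 : HasDerivAt (fun r : ℝ => (p - 1) / 2 * r) ((p - 1) / 2 * 1) r :=
    (hasDerivAt_id r).const_mul _
  have h2 := ((((Real.hasDerivAt_cosh _).comp r h1).pow 2).const_mul (2 / (p + 1))).rpow_const
    (p := 1 / (1 - p)) (Or.inl h0.ne')
  refine h2.congr_deriv ?_
  simp only [Function.comp_apply, Pi.pow_apply]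
  unfold w1
  rw [Real.rpow_sub_one h0.ne', Real.tanh_eq_sinh_div_cosh]
  have : (1 - p) ≠ 0 := by linarith
  have : (p + 1) ≠ 0 := by linarith
  field_simp
  ring

lemma w_hasDerivAt {p k : ℝ} (hp : 1 < p) (r : ℝ) :
    HasDerivAt (w p k) (-slope p k r * w p k r) r := by
  have h1 : HasDerivAt (fun r : ℝ => Real.sqrt k * r) (Real.sqrt k * 1) r :=
    (hasDerivAt_id r).const_mul _
  have h2 := ((w1_hasDerivAt hp _).comp r h1).const_mul (k ^ (1 / (p - 1)))
  refine h2.congr_deriv ?_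
  unfold w slope
  ring

lemma continuous_w {p : ℝ} (hp : 1 < p) (k : ℝ) : Continuous (w p k) :=
  continuous_iff_continuousAt.2 fun r => (w_hasDerivAt hp r).continuousAt

lemma w_rpow_sub_one {p k : ℝ} (hp : 1 < p) (hk : 0 < k) (r : ℝ) :
    w p k r ^ (p - 1) = (p + 1) / 2 * (k - slope p k r ^ 2) := by
  have hc := Real.cosh_pos ((p - 1) / 2 * (Real.sqrt k * r))
  have h0 : 0 < 2 / (p + 1) * Real.cosh ((p - 1) / 2 * (Real.sqrt k * r)) ^ 2 :=
    mul_pos (div_pos two_pos (by linarith)) (by positivity)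
  have hp' : p - 1 ≠ 0 := by linarith
  have hp'' : 1 - p ≠ 0 := by linarith
  have hp3 : p + 1 ≠ 0 := by linarith
  have e1 : 1 / (p - 1) * (p - 1) = 1 := by field_simp
  have e2 : 1 / (1 - p) * (p - 1) = -1 := by field_simp; ring
  unfold w
  rw [Real.mul_rpow (by positivity) (w1_pos hp _).le, ← Real.rpow_mul hk.le]
  unfold w1 slope
  rw [← Real.rpow_mul h0.le, e1, e2, Real.rpow_one, Real.rpow_neg_one, mul_pow,
    Real.sq_sqrt hk.le, Real.tanh_eq_sinh_div_cosh]
  have := Real.cosh_sq ((p - 1) / 2 * (Real.sqrt k * r))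
  generalize (p - 1) / 2 * (Real.sqrt k * r) = x at *
  field_simp
  rw [this]; ring

lemma w_rpow {p k : ℝ} (hp : 1 < p) (hk : 0 < k) (r : ℝ) :
    w p k r ^ p = (p + 1) / 2 * (k - slope p k r ^ 2) * w p k r := by
  rw [← w_rpow_sub_one hp hk, Real.rpow_sub_one (w_pos hp hk r).ne']
  have := (w_pos hp hk r).ne'
  field_simp

/-- The first integral `w_k'² = k w_k² - (2 / (p + 1)) w_k ^ (p + 1)`, solved for the power. -/
lemma w_rpow_add_one {p k : ℝ} (hp : 1 < p) (hk : 0 < k) (r : ℝ) :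
    w p k r ^ (p + 1) = (p + 1) / 2 * (k - slope p k r ^ 2) * w p k r ^ 2 := by
  rw [Real.rpow_add_one (w_pos hp hk r).ne', w_rpow hp hk]
  ring

lemma deriv_w {p : ℝ} (hp : 1 < p) (k : ℝ) : deriv (w p k) = fun r => -slope p k r * w p k r :=
  funext fun r => (w_hasDerivAt hp r).deriv

lemma w_deriv_hasDerivAt {p k : ℝ} (hp : 1 < p) (hk : 0 < k) (r : ℝ) :
    HasDerivAt (fun r => -slope p k r * w p k r) (k * w p k r - w p k r ^ p) r := by
  have h := (slope_hasDerivAt p hk r).fun_neg.fun_mul (w_hasDerivAt (k := k) hp r)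
  refine h.congr_deriv ?_
  rw [w_rpow hp hk]
  ring

lemma contDiff_w {p k : ℝ} (hp : 1 < p) (hk : 0 < k) : ContDiff ℝ 2 (w p k) := by
  have e : (2 : WithTop ℕ∞) = 1 + 1 := by norm_num
  rw [e, contDiff_succ_iff_deriv]
  refine ⟨fun r => (w_hasDerivAt hp r).differentiableAt, by simp, ?_⟩
  rw [deriv_w hp, contDiff_one_iff_deriv]
  refine ⟨fun r => (w_deriv_hasDerivAt hp hk r).differentiableAt, ?_⟩
  rw [show deriv (fun r => -slope p k r * w p k r) = fun r => k * w p k r - w p k r ^ p from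
    funext fun r => (w_deriv_hasDerivAt hp hk r).deriv]
  have := continuous_w hp k
  exact (continuous_const.mul this).sub
    (this.rpow_const fun r => Or.inl (w_pos hp hk r).ne')

lemma integrable_exp_neg_two_mul_abs : Integrable fun r : ℝ => Real.exp (-2 * |r|) := by
  rw [← integrableOn_univ, ← Iic_union_Ioi (a := (0 : ℝ))]
  refine IntegrableOn.union ?_ ?_
  · refine (integrableOn_exp_mul_Iic (a := 2) two_pos 0).congr_fun (fun x hx => ?_)
      measurableSet_Iic
    simp only [abs_of_nonpos (mem_Iic.1 hx)]
    ring_nf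
  · refine (integrableOn_exp_mul_Ioi (a := -2) (by norm_num) 0).congr_fun (fun x hx => ?_)
      measurableSet_Ioi
    simp only [abs_of_pos (mem_Ioi.1 hx)]

lemma integrable_w1_sq {p : ℝ} (hp : 1 < p) : Integrable fun r => w1 p r ^ 2 := by
  have hcont : Continuous (w1 p) :=
    continuous_iff_continuousAt.2 fun r => (w1_hasDerivAt hp r).continuousAt
  refine ((integrable_exp_neg_two_mul_abs).const_mul
    ((2 / (p + 1) * (1 / 4)) ^ (2 / (1 - p)))).mono' (hcont.pow 2).aestronglyMeasurable
    (Eventually.of_forall fun r => ?_)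
  have hc0 : (0 : ℝ) < 2 / (p + 1) := div_pos two_pos (by linarith)
  have hcosh : Real.exp |(p - 1) / 2 * r| / 2 ≤ Real.cosh ((p - 1) / 2 * r) := by
    rw [← Real.cosh_abs, Real.cosh_eq]
    have := Real.exp_pos (-|(p - 1) / 2 * r|)
    linarith
  have hb : 0 < 2 / (p + 1) * Real.cosh ((p - 1) / 2 * r) ^ 2 :=
    mul_pos hc0 (pow_pos (Real.cosh_pos _) 2)
  have hsq : (2 / (p + 1) * (1 / 4)) * Real.exp ((p - 1) * |r|)
      ≤ 2 / (p + 1) * Real.cosh ((p - 1) / 2 * r) ^ 2 := by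
    have e : Real.exp ((p - 1) * |r|) = Real.exp |(p - 1) / 2 * r| ^ 2 := by
      rw [← Real.exp_nat_mul, abs_mul, abs_of_pos (show 0 < (p - 1) / 2 by linarith)]
      congr 1; push_cast; ring
    have h2 := pow_le_pow_left₀ (by positivity) hcosh 2
    rw [e, mul_assoc]
    refine mul_le_mul_of_nonneg_left ?_ hc0.le
    linarith [div_pow (Real.exp |(p - 1) / 2 * r|) 2 2]
  have hneg : 2 / (1 - p) ≤ 0 := div_nonpos_of_nonneg_of_nonpos (by norm_num) (by linarith)
  have hp' : 1 - p ≠ 0 := by linarith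
  rw [Real.norm_of_nonneg (by positivity)]
  calc w1 p r ^ 2 = (2 / (p + 1) * Real.cosh ((p - 1) / 2 * r) ^ 2) ^ (2 / (1 - p)) := by
        unfold w1
        rw [← Real.rpow_natCast, ← Real.rpow_mul hb.le]
        congr 1; push_cast; ring
    _ ≤ ((2 / (p + 1) * (1 / 4)) * Real.exp ((p - 1) * |r|)) ^ (2 / (1 - p)) :=
        Real.rpow_le_rpow_of_nonpos (by positivity) hsq hneg
    _ = _ := by
        rw [Real.mul_rpow (by positivity) (by positivity), ← Real.exp_mul]
        congr 2
        field_simp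
        ring

lemma integrable_w_sq {p k : ℝ} (hp : 1 < p) (hk : 0 < k) :
    Integrable fun r => w p k r ^ 2 := by
  have h := ((integrable_w1_sq hp).comp_mul_left' (Real.sqrt_pos.2 hk).ne').const_mul
    ((k ^ (1 / (p - 1))) ^ 2)
  refine h.congr (Eventually.of_forall fun r => ?_)
  simp [w, mul_pow]

lemma m_pos {p : ℝ} (hp : 1 < p) : 0 < m p := by
  unfold m
  rw [integral_pos_iff_support_of_nonneg (fun r => sq_nonneg _) (integrable_w1_sq hp)]
  have : Function.support (fun r => w1 p r ^ 2) = univ := by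
    ext r; simp [(w1_pos hp r).ne']
  rw [this]; simp

/-- The mass `∫ w_k² = m k ^ ((5 - p) / (2 (p - 1)))`, by scaling. -/
lemma integral_w_sq {p k : ℝ} (hk : 0 < k) :
    ∫ r, w p k r ^ 2 = m p * k ^ (2 / (p - 1) - 1 / 2) := by
  have hs := Real.sqrt_pos.2 hk
  have : ∀ r, w p k r ^ 2 = (k ^ (1 / (p - 1))) ^ 2 * (fun x => w1 p x ^ 2) (Real.sqrt k * r) := by
    intro r; simp [w, mul_pow]
  rw [integral_congr_ae (Eventually.of_forall this)]
  rw [integral_const_mul, Measure.integral_comp_mul_left (fun x => w1 p x ^ 2),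
    abs_of_pos (inv_pos.2 hs), smul_eq_mul,
    Real.rpow_sub hk, ← Real.sqrt_eq_rpow, ← Real.rpow_natCast, ← Real.rpow_mul hk.le]
  unfold m
  have e : 1 / (p - 1) * (2 : ℕ) = 2 / (p - 1) := by push_cast; ring
  rw [e]
  field_simp

lemma integrable_weight_mul_w_sq {p k C : ℝ} (hp : 1 < p) (hk : 0 < k) {f : ℝ → ℝ}
    (hf : Continuous f) (hC : ∀ r, |f r| ≤ C) : Integrable fun r => f r * w p k r ^ 2 :=
  (integrable_w_sq hp hk).bdd_mul hf.aestronglyMeasurable (Eventually.of_forall hC)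

lemma integrable_slope_sq_mul {p k : ℝ} (hp : 1 < p) (hk : 0 < k) :
    Integrable fun r => slope p k r ^ 2 * w p k r ^ 2 :=
  integrable_weight_mul_w_sq (C := k) hp hk ((continuous_slope p hk).pow 2) fun r => by
    rw [abs_of_nonneg (sq_nonneg _)]; exact (slope_sq_lt p hk r).le

/-- `∫ w_k'² = ((p - 1) / (p + 3)) k ∫ w_k²`: the integral of `(w_k w_k')'` vanishes, and both
`w_k w_k''` and `w_k'²` are combinations of `w_k²` and `w_k'²` by the first integral. -/
lemma integral_slope_sq_mul {p k : ℝ} (hp : 1 < p) (hk : 0 < k) :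
    ∫ r, slope p k r ^ 2 * w p k r ^ 2 = (p - 1) / (p + 3) * (k * ∫ r, w p k r ^ 2) := by
  have hi1 := integrable_slope_sq_mul hp hk
  have hi2 := integrable_w_sq hp hk
  have hd : ∀ r, HasDerivAt (fun r => slope p k r * w p k r ^ 2)
      ((p - 1) / 2 * k * w p k r ^ 2 - (p + 3) / 2 * (slope p k r ^ 2 * w p k r ^ 2)) r := by
    intro r
    have h := (slope_hasDerivAt p hk r).fun_mul ((w_hasDerivAt (k := k) hp r).fun_pow 2)
    refine h.congr_deriv ?_
    push_cast
    ring
  have hz := integral_eq_zero_of_hasDerivAt_of_integrable hd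
    ((hi2.const_mul _).sub (hi1.const_mul _))
    (integrable_weight_mul_w_sq (C := Real.sqrt k) hp hk (continuous_slope p hk) fun r =>
      Real.abs_le_sqrt (slope_sq_lt p hk r).le)
  rw [integral_sub (hi2.const_mul _) (hi1.const_mul _), integral_const_mul, integral_const_mul]
    at hz
  have : p + 3 ≠ 0 := by linarith
  field_simp
  linarith

/-- Every positive number `A` is the height of a profile; `k` is found from the first integral at
`r = 0`, where `w_k'` vanishes. -/
lemma w_zero_eq {p A : ℝ} (hp : 1 < p) (hA : 0 < A) : w p (2 / (p + 1) * A ^ (p - 1)) 0 = A := by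
  have hc0 : (0 : ℝ) < 2 / (p + 1) := div_pos two_pos (by linarith)
  have hp' : p - 1 ≠ 0 := by linarith
  have hp'' : 1 - p ≠ 0 := by linarith
  unfold w w1
  simp only [mul_zero, Real.cosh_zero, one_pow, mul_one]
  rw [Real.mul_rpow hc0.le (by positivity), ← Real.rpow_mul hA.le, mul_right_comm,
    ← Real.rpow_add hc0]
  have e1 : 1 / (p - 1) + 1 / (1 - p) = 0 := by
    rw [show 1 - p = -(p - 1) by ring, div_neg]; ring
  have e2 : (p - 1) * (1 / (p - 1)) = 1 := by field_simp
  rw [e1, e2]; simp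

/-! ### Absolutely continuous representatives -/

/-- `v` is a primitive of the locally integrable function `g`, in the sense of the Lebesgue
integral; equivalently, `v` is locally absolutely continuous with derivative `g` almost
everywhere. -/
structure IsPrimitive (v g : ℝ → ℝ) : Prop where
  intervalIntegrable : ∀ a b, IntervalIntegrable g volume a b
  integral_eq : ∀ a b, ∫ x in a..b, g x = v b - v a

lemma isPrimitive_integral {g : ℝ → ℝ} (hg : ∀ a b, IntervalIntegrable g volume a b) (c : ℝ) :
    IsPrimitive (fun x => c + ∫ t in (0 : ℝ)..x, g t) g := by
  refine ⟨hg, fun a b => ?_⟩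
  rw [add_sub_add_left_eq_sub, intervalIntegral.integral_interval_sub_left (hg _ _) (hg _ _)]

lemma isPrimitive_of_hasDerivAt {v g : ℝ → ℝ} (h : ∀ x, HasDerivAt v (g x) x)
    (hg : Continuous g) : IsPrimitive v g :=
  ⟨fun a b => hg.intervalIntegrable a b, fun a b =>
    intervalIntegral.integral_eq_sub_of_hasDerivAt (fun x _ => h x) (hg.intervalIntegrable a b)⟩

namespace IsPrimitive

variable {v g : ℝ → ℝ}

lemma eq_add (h : IsPrimitive v g) (a : ℝ) : v = fun x => v a + ∫ t in a..x, g t := by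
  ext x; rw [h.integral_eq]; ring

lemma absolutelyContinuousOnInterval (h : IsPrimitive v g) (a b : ℝ) :
    AbsolutelyContinuousOnInterval v a b := by
  rw [h.eq_add a]
  have h1 : AbsolutelyContinuousOnInterval (fun _ : ℝ => v a) a b :=
    ((LipschitzWith.const (v a)).lipschitzOnWith).absolutelyContinuousOnInterval
  exact h1.add
    ((h.intervalIntegrable a b).absolutelyContinuousOnInterval_intervalIntegral left_mem_uIcc)

lemma continuous (h : IsPrimitive v g) : Continuous v := by
  rw [h.eq_add 0]
  exact continuous_const.add (intervalIntegral.continuous_primitive h.intervalIntegrable 0)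

lemma ae_hasDerivAt (h : IsPrimitive v g) (a b : ℝ) :
    ∀ᵐ x, x ∈ uIcc a b → HasDerivAt v (g x) x := by
  filter_upwards [(h.intervalIntegrable a b).ae_hasDerivAt_integral] with x hx hxm
  have := (hx hxm a left_mem_uIcc).const_add (v a)
  rwa [← h.eq_add a] at this

/-- Chain rule for the composition of a `C¹` function with an absolutely continuous function. -/
lemma comp (h : IsPrimitive v g) {F f : ℝ → ℝ} (hF : ∀ s, HasDerivAt F (f s) s)
    (hf : Continuous f) : IsPrimitive (fun x => F (v x)) (fun x => f (v x) * g x) := by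
  refine ⟨fun a b => (h.intervalIntegrable a b).continuousOn_mul
    (hf.comp h.continuous).continuousOn, fun a b => ?_⟩
  have hac : AbsolutelyContinuousOnInterval (fun x => F (v x)) a b := by
    obtain ⟨C, hC⟩ := (h.absolutelyContinuousOnInterval a b).exists_bound
    obtain ⟨K, hK⟩ := (isCompact_Icc (a := -C) (b := C)).exists_bound_of_continuousOn
      hf.continuousOn
    have hlip : ∀ s ∈ Icc (-C) C, ∀ t ∈ Icc (-C) C, dist (F s) (F t) ≤ |K| * dist s t := by
      intro s hs t ht
      rw [dist_eq_norm, dist_eq_norm]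
      exact (convex_Icc (-C) C).norm_image_sub_le_of_norm_hasDerivWithin_le
        (fun x _ => (hF x).hasDerivWithinAt) (fun x hx => (hK x hx).trans (le_abs_self K)) ht hs
    have hv := (absolutelyContinuousOnInterval_iff _ _ _).1 (h.absolutelyContinuousOnInterval a b)
    rw [absolutelyContinuousOnInterval_iff]
    intro ε hε
    obtain ⟨δ, hδ, H⟩ := hv (ε / (|K| + 1)) (by positivity)
    refine ⟨δ, hδ, fun E hE hs => ?_⟩
    have hlt := H E hE hs
    have hb : ∀ x ∈ uIcc a b, v x ∈ Icc (-C) C := fun x hx => abs_le.1 (hC x hx)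
    calc ∑ i ∈ Finset.range E.1, dist (F (v (E.2 i).1)) (F (v (E.2 i).2))
        ≤ ∑ i ∈ Finset.range E.1, |K| * dist (v (E.2 i).1) (v (E.2 i).2) :=
          Finset.sum_le_sum fun i hi =>
            hlip _ (hb _ (hE.1 i hi).1) _ (hb _ (hE.1 i hi).2)
      _ = |K| * ∑ i ∈ Finset.range E.1, dist (v (E.2 i).1) (v (E.2 i).2) :=
          (Finset.mul_sum _ _ _).symm
      _ ≤ |K| * (ε / (|K| + 1)) := by gcongr
      _ < ε := by
          rw [mul_div_assoc', div_lt_iff₀ (by positivity)]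
          nlinarith
  rw [← hac.integral_deriv_eq_sub]
  refine intervalIntegral.integral_congr_ae ?_
  filter_upwards [h.ae_hasDerivAt a b] with x hx hxm
  exact ((hF (v x)).comp x (hx (uIoc_subset_uIcc hxm))).deriv.symm

lemma comp_neg (h : IsPrimitive v g) :
    IsPrimitive (fun x => v (-x)) (fun x => -g (-x)) := by
  refine ⟨fun a b => ?_, fun a b => ?_⟩
  · have := ((IntervalIntegrable.iff_comp_neg (f := g) (a := -a) (b := -b)).1
      (h.intervalIntegrable (-a) (-b))).neg
    rw [neg_neg, neg_neg] at this
    exact this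
  · rw [intervalIntegral.integral_neg, intervalIntegral.integral_comp_neg, h.integral_eq]
    ring

lemma tendsto_atTop (h : IsPrimitive v g) (hg : Integrable g) (hv : Integrable v) :
    Tendsto v atTop (𝓝 0) := by
  have hlim : Tendsto v atTop (𝓝 (v 0 + ∫ t in Ioi (0 : ℝ), g t)) := by
    conv in Tendsto v => rw [h.eq_add 0]
    exact (intervalIntegral_tendsto_integral_Ioi 0 hg.integrableOn tendsto_id).const_add _
  have h0 : v 0 + ∫ t in Ioi (0 : ℝ), g t = 0 := by
    refine IntegrableAtFilter.eq_zero_of_tendsto ⟨univ, univ_mem, hv.integrableOn⟩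
      (μ := volume) ?_ hlim
    intro s hs
    rcases mem_atTop_sets.1 hs with ⟨b, hb⟩
    rw [← top_le_iff, ← Real.volume_Ici (a := b)]
    exact measure_mono hb
  rwa [h0] at hlim

/-- An `H¹` function vanishes at `+∞`. -/
lemma tendsto_atTop_of_memLp (h : IsPrimitive v g) (hv : MemLp v 2 volume)
    (hg : MemLp g 2 volume) : Tendsto v atTop (𝓝 0) := by
  have hsq : IsPrimitive (fun x => v x ^ 2) (fun x => 2 * v x * g x) :=
    h.comp (F := fun s => s ^ 2) (f := fun s => 2 * s)
      (fun s => by simpa using hasDerivAt_pow 2 s) (by fun_prop)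
  have hi : Integrable fun x => 2 * v x * g x := by
    have := (hv.integrable_mul hg).const_mul 2
    refine this.congr (Eventually.of_forall fun x => ?_)
    simp [mul_assoc]
  have := (hsq.tendsto_atTop hi hv.integrable_sq).sqrt
  rw [Real.sqrt_zero] at this
  exact (tendsto_zero_iff_abs_tendsto_zero _).2
    (this.congr fun x => by simp [Real.sqrt_sq_eq_abs])

end IsPrimitive

lemma exists_tsupport_subset_Ioo {φ : ℝ → ℝ} (hc : HasCompactSupport φ) :
    ∃ R : ℝ, tsupport φ ⊆ Ioo (-R) R := by
  obtain ⟨R, hR⟩ := hc.isCompact.isBounded.subset_ball 0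
  refine ⟨R, ?_⟩
  rwa [Real.ball_eq_Ioo, zero_sub, zero_add] at hR

/-- Primitives of locally integrable functions have them as weak derivatives. -/
lemma IsPrimitive.isWeakDeriv {v g : ℝ → ℝ} (h : IsPrimitive v g) : IsWeakDeriv v g := by
  intro φ hφ hc
  obtain ⟨R, hR⟩ := exists_tsupport_subset_Ioo hc
  have hφd : Differentiable ℝ φ := hφ.differentiable (by simp)
  have hφ' : Continuous (deriv φ) := hφ.continuous_deriv (by simp)
  have hsub : ∀ f : ℝ → ℝ, Function.support f ⊆ tsupport φ → Function.support f ⊆ Ioc (-R) R :=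
    fun f hf => hf.trans (hR.trans Ioo_subset_Ioc_self)
  have e1 : ∫ r, v r * deriv φ r = ∫ r in (-R)..R, v r * deriv φ r :=
    (intervalIntegral.integral_eq_integral_of_support_subset (hsub _ fun x hx =>
      support_deriv_subset (right_ne_zero_of_mul hx))).symm
  have e2 : ∫ r, g r * φ r = ∫ r in (-R)..R, g r * φ r :=
    (intervalIntegral.integral_eq_integral_of_support_subset (hsub _ fun x hx =>
      subset_tsupport φ (right_ne_zero_of_mul hx))).symm
  have hz : ∀ x, x ∉ Ioo (-R) R → φ x = 0 := fun x hx =>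
    image_eq_zero_of_notMem_tsupport fun h => hx (hR h)
  have hac : AbsolutelyContinuousOnInterval φ (-R) R :=
    ((hφ.of_le (by simp)).contDiffOn (n := 1)).absolutelyContinuousOnInterval
  rw [e1, e2, (h.absolutelyContinuousOnInterval _ _).integral_mul_deriv_eq_deriv_mul hac,
    hz R (by simp), hz (-R) (by simp)]
  simp only [mul_zero, sub_zero, zero_sub, neg_inj]
  refine intervalIntegral.integral_congr_ae ?_
  filter_upwards [h.ae_hasDerivAt (-R) R] with x hx hxm
  rw [(hx (uIoc_subset_uIcc hxm)).deriv]

/-- A test function with vanishing integral is the derivative of a test function. -/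
lemma exists_testFunction_deriv_eq {ψ : ℝ → ℝ} (hψ : ContDiff ℝ (⊤ : ℕ∞) ψ)
    (hc : HasCompactSupport ψ) (h0 : ∫ x, ψ x = 0) :
    ∃ Ψ : ℝ → ℝ, ContDiff ℝ (⊤ : ℕ∞) Ψ ∧ HasCompactSupport Ψ ∧ deriv Ψ = ψ := by
  obtain ⟨R, hR⟩ := exists_tsupport_subset_Ioo hc
  have hz : ∀ x, x ∉ Ioo (-R) R → ψ x = 0 := fun x hx =>
    image_eq_zero_of_notMem_tsupport fun h => hx (hR h)
  have hd : ∀ x, HasDerivAt (fun x => ∫ t in (-R)..x, ψ t) (ψ x) x := fun x =>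
    intervalIntegral.integral_hasDerivAt_right (hψ.continuous.intervalIntegrable _ _)
      (hψ.continuous.stronglyMeasurableAtFilter _ _) hψ.continuous.continuousAt
  have hd' : deriv (fun x => ∫ t in (-R)..x, ψ t) = ψ := funext fun x => (hd x).deriv
  refine ⟨fun x => ∫ t in (-R)..x, ψ t, ?_, ?_, hd'⟩
  · rw [contDiff_infty_iff_deriv, hd']
    exact ⟨fun x => (hd x).differentiableAt, hψ⟩
  · refine HasCompactSupport.intro (isCompact_Icc (a := -R) (b := R)) fun x hx => ?_
    rcases lt_or_ge x (-R) with h | h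
    · refine intervalIntegral.integral_zero_ae (Eventually.of_forall fun t ht => hz t ?_)
      rw [uIoc_of_ge h.le] at ht
      exact fun h' => (ht.2.trans_lt h'.1).false
    · have hx' : R < x := by
        by_contra hcon
        exact hx ⟨h, not_lt.1 hcon⟩
      change ∫ t in (-R)..x, ψ t = 0
      rw [intervalIntegral.integral_eq_integral_of_support_subset, h0]
      exact fun t ht => (hR (subset_tsupport ψ ht)).imp id fun h' => (h'.trans hx').le

/-- The lemma of du Bois-Reymond: a function with vanishing weak derivative is constant. -/
lemma ae_eq_const_of_isWeakDeriv_zero {f : ℝ → ℝ} (hf : LocallyIntegrable f volume)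
    (h : ∀ φ : ℝ → ℝ, ContDiff ℝ (⊤ : ℕ∞) φ → HasCompactSupport φ →
      ∫ r, f r * deriv φ r = 0) : ∃ c : ℝ, ∀ᵐ x, f x = c := by
  let b : ContDiffBump (0 : ℝ) := default
  let η : ℝ → ℝ := b.normed volume
  have hη : ContDiff ℝ (⊤ : ℕ∞) η := b.contDiff_normed
  have hηc : HasCompactSupport η := b.hasCompactSupport_normed
  have hη1 : ∫ x, η x = 1 := b.integral_normed
  have hint : ∀ φ : ℝ → ℝ, ContDiff ℝ (⊤ : ℕ∞) φ → HasCompactSupport φ →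
      Integrable (fun x => f x * φ x) := by
    intro φ hφ hc
    have := hf.integrable_smul_right_of_hasCompactSupport hφ.continuous hc
    simpa [smul_eq_mul] using this
  refine ⟨∫ x, f x * η x, ?_⟩
  refine ae_eq_of_integral_contDiff_smul_eq hf (locallyIntegrable_const _) fun φ hφ hc => ?_
  have hφi : Integrable φ := hφ.continuous.integrable_of_hasCompactSupport hc
  have hηi : Integrable η := hη.continuous.integrable_of_hasCompactSupport hηc
  obtain ⟨Ψ, hΨ, hΨc, hΨd⟩ := exists_testFunction_deriv_eq
    (ψ := fun x => φ x - (∫ y, φ y) * η x) (hφ.sub (contDiff_const.mul hη))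
    (by
      have h2 : HasCompactSupport (fun x => (∫ y, φ y) * η x) := hηc.mul_left
      exact hc.sub h2)
    (by rw [integral_sub hφi (hηi.const_mul _), integral_const_mul, hη1]; ring)
  have key := h Ψ hΨ hΨc
  rw [hΨd] at key
  have e : ∀ x, f x * (φ x - (∫ y, φ y) * η x) = f x * φ x - (∫ y, φ y) * (f x * η x) :=
    fun x => by ring
  simp_rw [e] at key
  rw [integral_sub (hint φ hφ hc) ((hint η hη hηc).const_mul _), integral_const_mul] at key
  simp only [smul_eq_mul]
  rw [integral_mul_const]
  simp_rw [mul_comm (φ _)]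
  linarith

/-- The weak derivative is unique among locally integrable functions. -/
lemma IsWeakDeriv.ae_eq {u g g' : ℝ → ℝ} (h : IsWeakDeriv u g) (h' : IsWeakDeriv u g')
    (hg : LocallyIntegrable g volume) (hg' : LocallyIntegrable g' volume) : g =ᵐ[volume] g' := by
  refine ae_eq_of_integral_contDiff_smul_eq hg hg' fun φ hφ hc => ?_
  have h1 := h φ hφ hc
  have h2 := h' φ hφ hc
  simp only [smul_eq_mul, mul_comm (φ _)]
  linarith

/-- Every function with a weak derivative has an absolutely continuous representative. -/
lemma IsWeakDeriv.exists_isPrimitive {u g : ℝ → ℝ} (h : IsWeakDeriv u g)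
    (hu : LocallyIntegrable u volume) (hg : LocallyIntegrable g volume) :
    ∃ v, u =ᵐ[volume] v ∧ IsPrimitive v g := by
  have hgi : ∀ a b, IntervalIntegrable g volume a b := fun a b =>
    (hg.integrableOn_isCompact isCompact_uIcc).intervalIntegrable
  let V : ℝ → ℝ := fun x => 0 + ∫ t in (0 : ℝ)..x, g t
  have hV : IsPrimitive V g := isPrimitive_integral hgi 0
  have hVl : LocallyIntegrable V volume := hV.continuous.locallyIntegrable
  obtain ⟨c, hc⟩ := ae_eq_const_of_isWeakDeriv_zero (f := u - V) (hu.sub hVl) (by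
    intro φ hφ hφc
    have hφ' : Continuous (deriv φ) := hφ.continuous_deriv (by simp)
    have h1 := h φ hφ hφc
    have h2 := hV.isWeakDeriv φ hφ hφc
    have i1 : Integrable fun r => u r * deriv φ r := by
      simpa using hu.integrable_smul_right_of_hasCompactSupport hφ' hφc.deriv
    have i2 : Integrable fun r => V r * deriv φ r := by
      simpa using hVl.integrable_smul_right_of_hasCompactSupport hφ' hφc.deriv
    simp only [Pi.sub_apply, sub_mul]
    rw [integral_sub i1 i2, h1, h2, sub_self])
  refine ⟨fun x => c + ∫ t in (0 : ℝ)..x, g t, ?_, isPrimitive_integral hgi c⟩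
  filter_upwards [hc] with x hx
  simp only [Pi.sub_apply, V, zero_add] at hx
  linarith

/-! ### Functions in `H¹(ℝ)` -/

lemma exists_abs_max {v : ℝ → ℝ} (hc : Continuous v) (ht : Tendsto v atTop (𝓝 0))
    (hb : Tendsto v atBot (𝓝 0)) : ∃ x₀, ∀ x, |v x| ≤ |v x₀| := by
  by_cases h : ∀ x, v x = 0
  · exact ⟨0, fun x => by simp [h]⟩
  · push Not at h
    obtain ⟨x₁, hx₁⟩ := h
    refine hc.abs.exists_forall_ge' x₁ ?_
    have hpos : |(0 : ℝ)| < |v x₁| := by simpa using hx₁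
    rw [cocompact_eq_atBot_atTop, eventually_sup]
    exact ⟨(hb.abs.eventually_lt_const hpos).mono fun _ => le_of_lt,
      (ht.abs.eventually_lt_const hpos).mono fun _ => le_of_lt⟩

lemma IsPrimitive.tendsto_atBot_of_memLp {v g : ℝ → ℝ} (h : IsPrimitive v g)
    (hv : MemLp v 2 volume) (hg : MemLp g 2 volume) : Tendsto v atBot (𝓝 0) := by
  have h1 : MemLp (fun x => v (-x)) 2 volume :=
    hv.comp_measurePreserving (Measure.measurePreserving_neg volume)
  have h2 : MemLp (fun x => -g (-x)) 2 volume :=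
    (hg.comp_measurePreserving (Measure.measurePreserving_neg volume)).neg
  have := (h.comp_neg.tendsto_atTop_of_memLp h1 h2).comp tendsto_neg_atBot_atTop
  simpa [Function.comp_def] using this

/-- An absolutely continuous function in `H¹(ℝ)` attains the maximum of its modulus. -/
lemma IsPrimitive.exists_abs_max {v g : ℝ → ℝ} (h : IsPrimitive v g)
    (hv : MemLp v 2 volume) (hg : MemLp g 2 volume) : ∃ x₀, ∀ x, |v x| ≤ |v x₀| :=
  GaugedNLS.exists_abs_max h.continuous (h.tendsto_atTop_of_memLp hv hg)
    (h.tendsto_atBot_of_memLp hv hg)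

lemma IsPrimitive.integrable_abs_rpow {v g : ℝ → ℝ} {p : ℝ} (hp : 1 < p) (h : IsPrimitive v g)
    (hv : MemLp v 2 volume) (hg : MemLp g 2 volume) :
    Integrable fun x => |v x| ^ (p + 1) := by
  obtain ⟨x₀, hx₀⟩ := h.exists_abs_max hv hg
  refine (hv.integrable_sq.const_mul (|v x₀| ^ (p - 1))).mono'
    (h.continuous.abs.rpow_const fun _ => Or.inr (by linarith)).aestronglyMeasurable
    (Eventually.of_forall fun x => ?_)
  rw [Real.norm_of_nonneg (by positivity), show p + 1 = (p - 1) + (2 : ℕ) by push_cast; ring,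
    Real.rpow_add_natCast' (abs_nonneg _) (by push_cast; linarith), sq_abs]
  exact mul_le_mul_of_nonneg_right
    (Real.rpow_le_rpow (abs_nonneg _) (hx₀ x) (by linarith)) (sq_nonneg _)

/-- The functional, computed from the absolutely continuous representative. -/
lemma exists_representative {u : ℝ → ℝ} (hu : u ∈ H1) :
    ∃ v g : ℝ → ℝ, IsPrimitive v g ∧ MemLp v 2 volume ∧ MemLp g 2 volume ∧ u =ᵐ[volume] v ∧
      ∀ p ω, J p ω u = 1 / 2 * ((∫ r, g r ^ 2) + ω * ∫ r, v r ^ 2)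
        + 1 / 24 * (∫ r, v r ^ 2) ^ 3 - 1 / (p + 1) * ∫ r, |v r| ^ (p + 1) := by
  obtain ⟨hu2, g, hg, hug⟩ := hu
  obtain ⟨v, huv, hv⟩ := hug.exists_isPrimitive (hu2.locallyIntegrable (by norm_num))
    (hg.locallyIntegrable (by norm_num))
  have hv2 : MemLp v 2 volume := hu2.ae_eq huv
  refine ⟨v, g, hv, hv2, hg, huv, fun p ω => ?_⟩
  have hw := weakDeriv_ae_eq hg hug
  have e1 : ∫ r, (|weakDeriv u r| ^ 2 + ω * u r ^ 2) = (∫ r, g r ^ 2) + ω * ∫ r, v r ^ 2 := by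
    rw [← integral_const_mul, ← integral_add hg.integrable_sq (hv2.integrable_sq.const_mul _)]
    refine integral_congr_ae ?_
    filter_upwards [hw, huv] with r h1 h2
    rw [h1, h2, sq_abs]
  have e2 : ∫ r, u r ^ 2 = ∫ r, v r ^ 2 :=
    integral_congr_ae (huv.mono fun r h => by simp only [h])
  have e3 : ∫ r, |u r| ^ (p + 1) = ∫ r, |v r| ^ (p + 1) :=
    integral_congr_ae (huv.mono fun r h => by simp only [h])
  rw [J, e1, e2, e3]

lemma memLp_w {p k : ℝ} (hp : 1 < p) (hk : 0 < k) : MemLp (w p k) 2 volume :=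
  (memLp_two_iff_integrable_sq (continuous_w hp k).aestronglyMeasurable).2 (integrable_w_sq hp hk)

lemma memLp_w_deriv {p k : ℝ} (hp : 1 < p) (hk : 0 < k) :
    MemLp (fun r => -slope p k r * w p k r) 2 volume := by
  refine (memLp_two_iff_integrable_sq
    ((continuous_slope p hk).neg.mul (continuous_w hp k)).aestronglyMeasurable).2 ?_
  refine (integrable_slope_sq_mul hp hk).congr (Eventually.of_forall fun r => ?_)
  simp only [Pi.mul_apply, Pi.neg_apply]
  ring

lemma isPrimitive_w {p k : ℝ} (hp : 1 < p) (hk : 0 < k) :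
    IsPrimitive (w p k) (fun r => -slope p k r * w p k r) :=
  isPrimitive_of_hasDerivAt (fun r => w_hasDerivAt hp r)
    ((continuous_slope p hk).neg.mul (continuous_w hp k))

lemma w_mem_H1 {p k : ℝ} (hp : 1 < p) (hk : 0 < k) : w p k ∈ H1 :=
  ⟨memLp_w hp hk, _, memLp_w_deriv hp hk, (isPrimitive_w hp hk).isWeakDeriv⟩

lemma J_w {p k : ℝ} (hp : 1 < p) (hk : 0 < k) (ω : ℝ) :
    J p ω (w p k) = (p - 1) / (p + 3) * (k * ∫ r, w p k r ^ 2)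
      + (ω - k) / 2 * (∫ r, w p k r ^ 2) + 1 / 24 * (∫ r, w p k r ^ 2) ^ 3 := by
  have hd := weakDeriv_ae_eq (memLp_w_deriv hp hk) (isPrimitive_w hp hk).isWeakDeriv
  have hi1 := integrable_slope_sq_mul hp hk
  have hi2 := integrable_w_sq hp hk
  have e1 : ∫ r, (|weakDeriv (w p k) r| ^ 2 + ω * w p k r ^ 2)
      = (∫ r, slope p k r ^ 2 * w p k r ^ 2) + ω * ∫ r, w p k r ^ 2 := by
    rw [← integral_const_mul, ← integral_add hi1 (hi2.const_mul _)]
    refine integral_congr_ae ?_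
    filter_upwards [hd] with r h1
    rw [h1, sq_abs]; ring
  have e3 : ∫ r, |w p k r| ^ (p + 1)
      = (p + 1) / 2 * (k * (∫ r, w p k r ^ 2) - ∫ r, slope p k r ^ 2 * w p k r ^ 2) := by
    rw [← integral_const_mul k, ← integral_sub (hi2.const_mul _) hi1, ← integral_const_mul]
    refine integral_congr_ae (Eventually.of_forall fun r => ?_)
    simp only
    rw [abs_of_pos (w_pos hp hk r), w_rpow_add_one hp hk]
    ring
  rw [J, e1, e3, integral_slope_sq_mul hp hk]
  have : p + 1 ≠ 0 := by linarith
  have : p + 3 ≠ 0 := by linarith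
  field_simp
  ring

/-! ### The sharp inequality -/

/-- The modulus `√(k s² - (2 / (p + 1)) |s| ^ (p + 1))` of the derivative of `w_k` as a function
of the value `s` of `w_k`; it calibrates the one-dimensional variational problem. It is `0`
where the radicand is negative, that is, for `|s| > w_k(0)`. -/
noncomputable def calib (p k s : ℝ) : ℝ :=
  Real.sqrt (k * s ^ 2 - 2 / (p + 1) * |s| ^ (p + 1))

lemma continuous_calib {p : ℝ} (hp : 1 < p) (k : ℝ) : Continuous (calib p k) := by
  unfold calib
  have : Continuous fun s : ℝ => |s| ^ (p + 1) :=
    continuous_abs.rpow_const fun _ => Or.inr (by linarith)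
  fun_prop

lemma calib_nonneg (p k s : ℝ) : 0 ≤ calib p k s := Real.sqrt_nonneg _

lemma calib_neg (p k s : ℝ) : calib p k (-s) = calib p k s := by simp [calib]

lemma calib_w {p k : ℝ} (hp : 1 < p) (hk : 0 < k) (r : ℝ) :
    calib p k (w p k r) = |slope p k r| * w p k r := by
  unfold calib
  rw [abs_of_pos (w_pos hp hk r), w_rpow_add_one hp hk]
  have : p + 1 ≠ 0 := by linarith
  rw [show k * w p k r ^ 2 - 2 / (p + 1) * ((p + 1) / 2 * (k - slope p k r ^ 2) * w p k r ^ 2)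
    = (slope p k r * w p k r) ^ 2 by field_simp; ring, Real.sqrt_sq_eq_abs, abs_mul,
    abs_of_pos (w_pos hp hk r)]

lemma calib_sq {p A s : ℝ} (hp : 1 < p) (hs : |s| ≤ A) :
    calib p (2 / (p + 1) * A ^ (p - 1)) s ^ 2 =
      2 / (p + 1) * A ^ (p - 1) * s ^ 2 - 2 / (p + 1) * |s| ^ (p + 1) := by
  refine Real.sq_sqrt ?_
  have e : |s| ^ (p + 1) = |s| ^ (p - 1) * s ^ 2 := by
    rw [show p + 1 = (p - 1) + (2 : ℕ) by push_cast; ring,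
      Real.rpow_add_natCast' (abs_nonneg _) (by push_cast; linarith), sq_abs]
  have h1 : |s| ^ (p - 1) ≤ A ^ (p - 1) :=
    Real.rpow_le_rpow (abs_nonneg _) hs (by linarith)
  have hc0 : (0 : ℝ) < 2 / (p + 1) := div_pos two_pos (by linarith)
  rw [e, mul_assoc, ← mul_sub, ← sub_mul]
  exact mul_nonneg hc0.le (mul_nonneg (sub_nonneg.2 h1) (sq_nonneg _))

/-- Bound on a half-line: the variation of a primitive `F` of `f` along `v` from `x₀` to
infinity. -/
lemma abs_integral_le_integral_Ioi {v g f : ℝ → ℝ} (h : IsPrimitive v g) (hf : Continuous f)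
    (hf0 : ∀ s, 0 ≤ f s) (ht : Tendsto v atTop (𝓝 0))
    (hi : Integrable fun x => f (v x) * |g x|) (x₀ : ℝ) :
    |∫ s in (0 : ℝ)..(v x₀), f s| ≤ ∫ x in Ioi x₀, f (v x) * |g x| := by
  have hF : ∀ s, HasDerivAt (fun s => ∫ t in (0 : ℝ)..s, f t) (f s) s := fun s =>
    intervalIntegral.integral_hasDerivAt_right (hf.intervalIntegrable _ _)
      (hf.stronglyMeasurableAtFilter _ _) hf.continuousAt
  have hcomp := h.comp hF hf
  have hF0 : Tendsto (fun b => ∫ t in (0 : ℝ)..(v b), f t) atTop (𝓝 0) := by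
    have := ((hF 0).continuousAt.tendsto).comp ht
    simpa [Function.comp_def] using this
  have hlim : Tendsto (fun b => |(∫ t in (0 : ℝ)..(v b), f t) - ∫ t in (0 : ℝ)..(v x₀), f t|)
      atTop (𝓝 |0 - ∫ t in (0 : ℝ)..(v x₀), f t|) := (hF0.sub_const _).abs
  rw [zero_sub, abs_neg] at hlim
  refine le_of_tendsto hlim ?_
  filter_upwards [eventually_ge_atTop x₀] with b hb
  rw [← hcomp.integral_eq x₀ b]
  refine (intervalIntegral.abs_integral_le_integral_abs hb).trans ?_
  rw [intervalIntegral.integral_of_le hb]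
  have e : ∀ x, |f (v x) * g x| = f (v x) * |g x| := fun x => by
    rw [abs_mul, abs_of_nonneg (hf0 _)]
  simp_rw [e]
  exact setIntegral_mono_set hi.integrableOn
    (Eventually.of_forall fun x => mul_nonneg (hf0 _) (abs_nonneg _))
    Ioc_subset_Ioi_self.eventuallyLE

/-- A function that vanishes at both ends and takes the value `± A` costs at least
`2 ∫₀ᴬ f` in the length weighted by the even function `f`. -/
lemma two_mul_integral_le {v g f : ℝ → ℝ} (h : IsPrimitive v g) (hf : Continuous f)
    (hf0 : ∀ s, 0 ≤ f s) (hfe : ∀ s, f (-s) = f s) (ht : Tendsto v atTop (𝓝 0))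
    (hb : Tendsto v atBot (𝓝 0)) (hi : Integrable fun x => f (v x) * |g x|) (x₀ : ℝ) :
    2 * ∫ s in (0 : ℝ)..|v x₀|, f s ≤ ∫ x, f (v x) * |g x| := by
  have habs : ∫ s in (0 : ℝ)..|v x₀|, f s ≤ |∫ s in (0 : ℝ)..(v x₀), f s| := by
    rcases abs_choice (v x₀) with hv | hv <;> rw [hv]
    · exact le_abs_self _
    · have : ∫ s in (0 : ℝ)..(-v x₀), f s = -∫ s in (0 : ℝ)..(v x₀), f s := by
        have h1 := intervalIntegral.integral_comp_neg (f := f) (a := 0) (b := v x₀)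
        simp only [hfe, neg_zero] at h1
        rw [h1, intervalIntegral.integral_symm]
      rw [this]
      exact neg_le_abs _
  have h1 := abs_integral_le_integral_Ioi h hf hf0 ht hi x₀
  have h2 := abs_integral_le_integral_Ioi (x₀ := -x₀) h.comp_neg hf hf0
    (hb.comp tendsto_neg_atTop_atBot) (by simpa only [abs_neg] using hi.comp_neg)
  simp only [neg_neg, abs_neg] at h2
  rw [integral_comp_neg_Ioi (f := fun x => f (v x) * |g x|), neg_neg] at h2
  have h3 : ∫ x, f (v x) * |g x|
      = (∫ x in Iic x₀, f (v x) * |g x|) + ∫ x in Ioi x₀, f (v x) * |g x| := by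
    rw [← setIntegral_univ, ← Iic_union_Ioi (a := x₀),
      setIntegral_union (Iic_disjoint_Ioi le_rfl) measurableSet_Ioi hi.integrableOn
        hi.integrableOn]
  linarith

/-- The profile itself realizes equality in the calibration bound. -/
lemma two_mul_integral_calib {p k : ℝ} (hp : 1 < p) (hk : 0 < k) :
    2 * ∫ s in (0 : ℝ)..(w p k 0), calib p k s = ∫ r, slope p k r ^ 2 * w p k r ^ 2 := by
  have hf := continuous_calib hp k
  have hF : ∀ s, HasDerivAt (fun s => ∫ t in (0 : ℝ)..s, calib p k t) (calib p k s) s := fun s =>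
    intervalIntegral.integral_hasDerivAt_right (hf.intervalIntegrable _ _)
      (hf.stronglyMeasurableAtFilter _ _) hf.continuousAt
  have hd : ∀ r ∈ Ici (0 : ℝ), HasDerivAt (fun r => ∫ t in (0 : ℝ)..(w p k r), calib p k t)
      (-(slope p k r ^ 2 * w p k r ^ 2)) r := by
    intro r hr
    refine ((hF (w p k r)).comp r (w_hasDerivAt hp r)).congr_deriv ?_
    rw [calib_w hp hk, abs_of_nonneg (slope_nonneg hp k hr)]
    ring
  have hlim : Tendsto (fun r => ∫ t in (0 : ℝ)..(w p k r), calib p k t) atTop (𝓝 0) := by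
    have := ((hF 0).continuousAt.tendsto).comp
      ((isPrimitive_w hp hk).tendsto_atTop_of_memLp (memLp_w hp hk) (memLp_w_deriv hp hk))
    simpa [Function.comp_def] using this
  have h1 := integral_Ioi_of_hasDerivAt_of_tendsto' hd
    (integrable_slope_sq_mul hp hk).neg.integrableOn hlim
  rw [integral_neg] at h1
  have h2 := integral_comp_abs (f := fun r => slope p k r ^ 2 * w p k r ^ 2)
  have h3 : ∀ r, slope p k |r| ^ 2 * w p k |r| ^ 2 = slope p k r ^ 2 * w p k r ^ 2 := by
    intro r
    rcases abs_choice r with h | h <;> rw [h]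
    rw [slope_neg, w_neg, neg_sq]
  simp only [h3] at h2
  rw [h2]
  linarith

/-- The sharp inequality at the frequency `k` fixed by the height of `v`. -/
lemma exists_action_ge {v g : ℝ → ℝ} {p : ℝ} (hp : 1 < p) (h : IsPrimitive v g)
    (hv : MemLp v 2 volume) (hg : MemLp g 2 volume) (hne : ∃ x, v x ≠ 0) :
    ∃ k, 0 < k ∧ (p - 1) / (p + 3) * (k * ∫ r, w p k r ^ 2) ≤
      1 / 2 * (∫ r, g r ^ 2) + k / 2 * (∫ r, v r ^ 2) - 1 / (p + 1) * ∫ r, |v r| ^ (p + 1) := by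
  obtain ⟨x₀, hx₀⟩ := h.exists_abs_max hv hg
  obtain ⟨x₁, hx₁⟩ := hne
  have hA : 0 < |v x₀| := (abs_pos.2 hx₁).trans_le (hx₀ x₁)
  have hc0 : (0 : ℝ) < 2 / (p + 1) := div_pos two_pos (by linarith)
  have hw0 := w_zero_eq hp hA
  have hk : 0 < 2 / (p + 1) * |v x₀| ^ (p - 1) := by positivity
  have hsq := fun x => calib_sq hp (hx₀ x)
  generalize 2 / (p + 1) * |v x₀| ^ (p - 1) = k at *
  refine ⟨k, hk, ?_⟩
  have hcal := continuous_calib hp k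
  have i1 := hg.integrable_sq.const_mul (1 / 2)
  have i2 := hv.integrable_sq.const_mul (k / 2)
  have i3 := (h.integrable_abs_rpow hp hv hg).const_mul (1 / (p + 1))
  have i12 : Integrable fun x => 1 / 2 * g x ^ 2 + k / 2 * v x ^ 2 := i1.add i2
  -- Young's inequality for the product `calib v * |g|`
  have hle : ∀ x, calib p k (v x) * |g x| ≤
      1 / 2 * g x ^ 2 + k / 2 * v x ^ 2 - 1 / (p + 1) * |v x| ^ (p + 1) := by
    intro x
    have h1 := two_mul_le_add_sq (calib p k (v x)) |g x|
    rw [hsq x, sq_abs] at h1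
    have : 1 / (p + 1) * |v x| ^ (p + 1) = 1 / 2 * (2 / (p + 1) * |v x| ^ (p + 1)) := by ring
    linarith
  have hi : Integrable fun x => calib p k (v x) * |g x| := by
    refine (i12.sub i3).mono'
      ((hcal.comp h.continuous).aestronglyMeasurable.mul hg.1.norm)
      (Eventually.of_forall fun x => ?_)
    rw [Real.norm_of_nonneg (mul_nonneg (calib_nonneg _ _ _) (abs_nonneg _))]
    exact hle x
  have h1 := two_mul_integral_le h hcal (calib_nonneg p k) (calib_neg p k)
    (h.tendsto_atTop_of_memLp hv hg) (h.tendsto_atBot_of_memLp hv hg) hi x₀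
  have h2 := integral_mono hi (i12.sub i3) hle
  simp only [Pi.sub_apply] at h2
  rw [integral_sub i12 i3, integral_add i1 i2, integral_const_mul, integral_const_mul,
    integral_const_mul] at h2
  rw [← integral_slope_sq_mul hp hk, ← two_mul_integral_calib hp hk, hw0]
  exact h1.trans h2

/-- The strict tangent line inequality for `t ^ (e + 1)` at `κ`, divided by `e + 1`. -/
lemma rpow_tangent_lt {e k κ : ℝ} (he : 0 < e) (hk : 0 < k) (hκ : 0 < κ) (hne : k ≠ κ) :
    1 / (e + 1) * (κ * κ ^ e) - κ * κ ^ e < 1 / (e + 1) * (k * k ^ e) - k * κ ^ e := by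
  have h := one_add_mul_self_lt_rpow_one_add (s := k / κ - 1) (by linarith [div_pos hk hκ])
    (sub_ne_zero.2 fun h => hne ((div_eq_one_iff_eq hκ.ne').1 h)) (show 1 < e + 1 by linarith)
  rw [add_sub_cancel, Real.div_rpow hk.le hκ.le, Real.rpow_add_one hk.ne',
    Real.rpow_add_one hκ.ne', lt_div_iff₀ (by positivity)] at h
  have h2 := mul_lt_mul_of_pos_left h (show 0 < 1 / (e + 1) by positivity)
  have e1 : 1 / (e + 1) * ((1 + (e + 1) * (k / κ - 1)) * (κ ^ e * κ))
      = 1 / (e + 1) * (κ * κ ^ e) - κ * κ ^ e + k * κ ^ e := by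
    field_simp
    ring
  rw [e1] at h2
  linarith

lemma rpow_tangent_le {e k κ : ℝ} (he : 0 < e) (hk : 0 < k) (hκ : 0 < κ) :
    1 / (e + 1) * (κ * κ ^ e) - κ * κ ^ e ≤ 1 / (e + 1) * (k * k ^ e) - k * κ ^ e := by
  rcases eq_or_ne k κ with rfl | hne
  · exact le_rfl
  · exact (rpow_tangent_lt he hk hκ hne).le

/-- Among functions of given mass, a profile minimizes `J`: every value of `J` other than that of
the zero function is bounded below by the value at a profile. -/
lemma J_eq_zero_or_exists_J_w_le {p ω : ℝ} (hp : 1 < p) (hp5 : p < 5) {u : ℝ → ℝ} (hu : u ∈ H1) :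
    J p ω u = 0 ∨ ∃ κ, 0 < κ ∧ J p ω (w p κ) ≤ J p ω u := by
  obtain ⟨v, g, h, hv, hg, huv, hJ⟩ := exists_representative hu
  by_cases hne : ∃ x, v x ≠ 0
  · right
    have he : 0 < 2 / (p - 1) - 1 / 2 := by
      rw [sub_pos, div_lt_div_iff₀ two_pos (by linarith)]; linarith
    have hm := m_pos hp
    obtain ⟨x₁, hx₁⟩ := hne
    have hM : 0 < ∫ r, v r ^ 2 :=
      integral_pos_of_integrable_nonneg_nonzero (h.continuous.pow 2) hv.integrable_sq
        (fun x => sq_nonneg _) (x := x₁) (pow_ne_zero 2 hx₁)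
    obtain ⟨k, hk, hle⟩ := exists_action_ge hp h hv hg ⟨x₁, hx₁⟩
    -- the profile `w_κ` has the same mass as `v`
    let κ : ℝ := ((∫ r, v r ^ 2) / m p) ^ (2 / (p - 1) - 1 / 2)⁻¹
    have hκ : 0 < κ := Real.rpow_pos_of_pos (div_pos hM hm) _
    have hmass : m p * κ ^ (2 / (p - 1) - 1 / 2) = ∫ r, v r ^ 2 := by
      rw [← Real.rpow_mul (div_pos hM hm).le, inv_mul_cancel₀ he.ne', Real.rpow_one]
      field_simp
    refine ⟨κ, hκ, ?_⟩
    have hy := rpow_tangent_le he hk hκ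
    have e1 : 1 / (2 / (p - 1) - 1 / 2 + 1) = 2 * ((p - 1) / (p + 3)) := by
      have : p - 1 ≠ 0 := by linarith
      have : p + 3 ≠ 0 := by linarith
      have : 2 / (p - 1) - 1 / 2 + 1 = (p + 3) / (2 * (p - 1)) := by field_simp; ring
      rw [this]; field_simp
    rw [e1] at hy
    rw [hJ, J_w hp hκ, integral_w_sq hκ, hmass]
    rw [integral_w_sq hk] at hle
    have hy2 := mul_le_mul_of_nonneg_left hy (by linarith : 0 ≤ m p / 2)
    have e2 : (p - 1) / (p + 3) * (κ * ∫ r, v r ^ 2) - κ / 2 * (∫ r, v r ^ 2)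
        ≤ (p - 1) / (p + 3) * (k * (m p * k ^ (2 / (p - 1) - 1 / 2)))
          - k / 2 * ∫ r, v r ^ 2 := by
      rw [← hmass]
      refine le_trans (le_of_eq ?_) (hy2.trans (le_of_eq ?_)) <;> ring
    linarith
  · left
    push Not at hne
    have hg0 : ∫ r, g r ^ 2 = 0 := by
      have : g =ᵐ[volume] 0 := by
        have h0 : IsPrimitive v (0 : ℝ → ℝ) := by
          have : v = fun _ => 0 := funext hne
          rw [this]
          exact isPrimitive_of_hasDerivAt (fun x => hasDerivAt_const x 0) continuous_const
        exact h.isWeakDeriv.ae_eq h0.isWeakDeriv (hg.locallyIntegrable (by norm_num))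
          (continuous_const (y := (0 : ℝ))).locallyIntegrable
      rw [integral_congr_ae (g := fun _ => (0 : ℝ)) (this.mono fun x hx => by simp [hx])]
      simp
    rw [hJ, hg0]
    simp [hne, Real.zero_rpow (show p + 1 ≠ 0 by linarith)]

/-! ### The profiles are the only positive even solutions -/

lemma isPositiveRadialSolution_w {p k : ℝ} (hp : 1 < p) (hk : 0 < k) :
    IsPositiveRadialSolution p k (w p k) where
  mem_H1 := w_mem_H1 hp hk
  pos := w_pos hp hk
  even := w_neg p k
  contDiff := contDiff_w hp hk
  equation r := by
    rw [deriv_w hp, (w_deriv_hasDerivAt hp hk r).deriv]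
    ring

namespace IsPositiveRadialSolution

variable {p k : ℝ} {v : ℝ → ℝ}

lemma hasDerivAt (h : IsPositiveRadialSolution p k v) (r : ℝ) :
    HasDerivAt v (deriv v r) r :=
  (h.contDiff.differentiable (by simp) r).hasDerivAt

lemma contDiff_deriv (h : IsPositiveRadialSolution p k v) : ContDiff ℝ 1 (deriv v) := by
  have h2 := h.contDiff
  rw [show (2 : WithTop ℕ∞) = 1 + 1 by norm_num, contDiff_succ_iff_deriv] at h2
  exact h2.2.2

lemma hasDerivAt_deriv (h : IsPositiveRadialSolution p k v) (r : ℝ) :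
    HasDerivAt (deriv v) (k * v r - v r ^ p) r := by
  have h1 := (h.contDiff_deriv.differentiable (by simp) r).hasDerivAt
  have h2 := h.equation r
  rwa [show deriv (deriv v) r = k * v r - v r ^ p by linarith] at h1

lemma deriv_zero (h : IsPositiveRadialSolution p k v) : deriv v 0 = 0 := by
  have h1 := deriv_comp_neg v 0
  rw [show (fun x => v (-x)) = v from funext h.even, neg_zero] at h1
  linarith

/-- Energy conservation: the energy is constant, and integrable because `v ∈ H¹(ℝ)`, hence it
vanishes. -/
lemma deriv_sq (h : IsPositiveRadialSolution p k v) (hp : 1 < p) (r : ℝ) :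
    deriv v r ^ 2 = k * v r ^ 2 - 2 / (p + 1) * v r ^ (p + 1) := by
  have hp1 : p + 1 ≠ 0 := by linarith
  have hprim : IsPrimitive v (deriv v) :=
    isPrimitive_of_hasDerivAt h.hasDerivAt h.contDiff_deriv.continuous
  obtain ⟨hv, g, hg, hvg⟩ := h.mem_H1
  have hgd : MemLp (deriv v) 2 volume :=
    hg.ae_eq (hvg.ae_eq hprim.isWeakDeriv (hg.locallyIntegrable (by norm_num))
      h.contDiff_deriv.continuous.locallyIntegrable)
  let E : ℝ → ℝ := fun r => deriv v r ^ 2 - k * v r ^ 2 + 2 / (p + 1) * v r ^ (p + 1)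
  have hE : ∀ r, HasDerivAt E 0 r := by
    intro r
    have h1 := (((h.hasDerivAt_deriv r).fun_pow 2).fun_sub
      (((h.hasDerivAt r).fun_pow 2).const_mul k)).fun_add
      (((h.hasDerivAt r).rpow_const (p := p + 1) (Or.inl (h.pos r).ne')).const_mul (2 / (p + 1)))
    refine h1.congr_deriv ?_
    rw [add_sub_cancel_right]
    field_simp
    push_cast
    ring
  have hconst : ∀ x, E x = E r := fun x =>
    is_const_of_deriv_eq_zero (fun x => (hE x).differentiableAt) (fun x => (hE x).deriv) x r
  have hint : Integrable E := by
    have h3 := (hprim.integrable_abs_rpow hp hv hgd).const_mul (2 / (p + 1))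
    simp_rw [abs_of_pos (h.pos _)] at h3
    exact (hgd.integrable_sq.sub (hv.integrable_sq.const_mul k)).add h3
  rw [funext hconst, integrable_const_iff] at hint
  have h0 : E r = 0 := hint.resolve_right fun hfin => by
    have := hfin.measure_univ_lt_top
    simp at this
  simp only [E] at h0
  linarith

lemma rpow_zero (h : IsPositiveRadialSolution p k v) (hp : 1 < p) :
    v 0 ^ (p - 1) = (p + 1) / 2 * k := by
  have h1 := h.deriv_sq hp 0
  have hv := h.pos 0
  rw [h.deriv_zero, show p + 1 = (p - 1) + (2 : ℕ) by push_cast; ring,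
    Real.rpow_add_natCast hv.ne'] at h1
  have hp1 : p - 1 + (2 : ℕ) ≠ 0 := by push_cast; linarith
  field_simp at h1
  push_cast at h1
  rw [zero_pow two_ne_zero, zero_mul] at h1
  have h2 := (mul_eq_zero.1 h1.symm).resolve_left (pow_ne_zero 2 hv.ne')
  linarith

/-- The substitution `z = v ^ (-(p - 1) / 2)` turns the equation into the linear equation
`z'' = ((p - 1) / 2)² k z`. -/
lemma rpow_eq_cosh (h : IsPositiveRadialSolution p k v) (hp : 1 < p) (hk : 0 < k) (r : ℝ) :
    v r ^ (-((p - 1) / 2)) =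
      v 0 ^ (-((p - 1) / 2)) * Real.cosh ((p - 1) / 2 * Real.sqrt k * r) := by
  have hp1 : p + 1 ≠ 0 := by linarith
  have hsk := Real.sq_sqrt hk.le
  have hl : 0 < (p - 1) / 2 * Real.sqrt k :=
    mul_pos (by linarith) (Real.sqrt_pos.2 hk)
  let a : ℝ := (p - 1) / 2
  let z : ℝ → ℝ := fun r => v r ^ (-a)
  let z' : ℝ → ℝ := fun r => -a * (v r ^ (-a - 1) * deriv v r)
  have hz : ∀ r, HasDerivAt z (z' r) r := by
    intro r
    refine ((h.hasDerivAt r).rpow_const (Or.inl (h.pos r).ne')).congr_deriv ?_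
    simp only [z']
    ring
  have hz' : ∀ r, HasDerivAt z' (((p - 1) / 2 * Real.sqrt k) ^ 2 * z r) r := by
    intro r
    have hv := h.pos r
    refine ((((h.hasDerivAt r).rpow_const (p := -a - 1) (Or.inl hv.ne')).fun_mul
      (h.hasDerivAt_deriv r)).const_mul (-a)).congr_deriv ?_
    have e1 : v r ^ (-a - 1 - 1) = z r / v r ^ 2 := by
      rw [Real.rpow_sub_one hv.ne', Real.rpow_sub_one hv.ne']
      field_simp
      rfl
    have e2 : v r ^ (-a - 1) = z r / v r := Real.rpow_sub_one hv.ne' _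
    have e3 : v r ^ (p + 1) = v r ^ p * v r := Real.rpow_add_one hv.ne' _
    have e4 : deriv v r * (-a - 1) * (z r / v r ^ 2) * deriv v r
        = (-a - 1) * (z r / v r ^ 2) * deriv v r ^ 2 := by ring
    rw [e1, e2, e4, h.deriv_sq hp, e3, mul_pow, hsk]
    simp only [a]
    field_simp
    ring
  have key : ∀ l : ℝ, l ^ 2 = ((p - 1) / 2 * Real.sqrt k) ^ 2 →
      z' r + l * z r = l * z 0 * Real.exp (l * r) := by
    intro l hl2
    have hd : ∀ x, HasDerivAt (fun x => (z' x + l * z x) * Real.exp (-l * x)) 0 x := by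
      intro x
      have he : HasDerivAt (fun x : ℝ => Real.exp (-l * x)) (Real.exp (-l * x) * (-l * 1)) x :=
        ((hasDerivAt_id x).const_mul (-l)).exp
      refine (((hz' x).fun_add ((hz x).const_mul l)).fun_mul he).congr_deriv ?_
      rw [← hl2]
      ring
    have hc := is_const_of_deriv_eq_zero (fun x => (hd x).differentiableAt)
      (fun x => (hd x).deriv) r 0
    have hz0 : z' 0 = 0 := by simp [z', h.deriv_zero]
    simp only [hz0, mul_zero, Real.exp_zero, mul_one, zero_add] at hc
    rw [← hc, mul_assoc, ← Real.exp_add]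
    simp
  have k1 := key _ rfl
  have k2 := key (-((p - 1) / 2 * Real.sqrt k)) (neg_sq _)
  change z r = z 0 * _
  rw [Real.cosh_eq]
  rw [neg_mul ((p - 1) / 2 * Real.sqrt k) r] at k2
  refine mul_left_cancel₀ hl.ne' ?_
  linarith

lemma eq_w (h : IsPositiveRadialSolution p k v) (hp : 1 < p) (hk : 0 < k) : v = w p k := by
  have hw := isPositiveRadialSolution_w hp hk
  have h0 : v 0 = w p k 0 :=
    (Real.rpow_left_inj (h.pos 0).le (hw.pos 0).le (show p - 1 ≠ 0 by linarith)).1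
      ((h.rpow_zero hp).trans (hw.rpow_zero hp).symm)
  ext r
  refine (Real.rpow_left_inj (h.pos r).le (hw.pos r).le
    (show -((p - 1) / 2) ≠ 0 by linarith)).1 ?_
  rw [h.rpow_eq_cosh hp hk, hw.rpow_eq_cosh hp hk, h0]

end IsPositiveRadialSolution

/-! ### The energy of the profiles -/

/-- The exponent `e = (5 - p) / (2 (p - 1))` of the mass `∫ w_k² = m k ^ e`. -/
noncomputable def massExp (p : ℝ) : ℝ := 2 / (p - 1) - 1 / 2

lemma half_lt_massExp {p : ℝ} (hp1 : 1 < p) (hp3 : p < 3) : 1 / 2 < massExp p := by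
  unfold massExp
  have : 1 < 2 / (p - 1) := by rw [lt_div_iff₀ (by linarith)]; linarith
  linarith

lemma two_mul_massExp {p : ℝ} (hp1 : 1 < p) : 2 * massExp p = (5 - p) / (p - 1) := by
  unfold massExp
  have : p - 1 ≠ 0 := by linarith
  field_simp
  ring

/-- The energy `J_ω(w_k) = (m / 2) k ^ e (ω - (e / (e + 1)) k + (m² / 12) k ^ (2 e))` as a function
of `k`, with `m` and `e` as parameters. -/
noncomputable def profileEnergy (m e ω k : ℝ) : ℝ :=
  m / 2 * k ^ e * (ω - e / (e + 1) * k + m ^ 2 / 12 * k ^ (2 * e))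

lemma J_w_eq_profileEnergy {p k : ℝ} (hp : 1 < p) (hk : 0 < k) (ω : ℝ) :
    J p ω (w p k) = profileEnergy (m p) (massExp p) ω k := by
  have hp1 : p - 1 ≠ 0 := by linarith
  have hp3 : p + 3 ≠ 0 := by linarith
  have e1 : massExp p / (massExp p + 1) = 1 - 2 * ((p - 1) / (p + 3)) := by
    have : massExp p + 1 = (p + 3) / (2 * (p - 1)) := by
      unfold massExp; field_simp; ring
    rw [this]
    unfold massExp
    field_simp
    ring
  rw [J_w hp hk, integral_w_sq hk, profileEnergy, e1, mul_comm 2 (massExp p), ← massExp,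
    Real.rpow_mul hk.le, Real.rpow_two]
  ring

lemma profileEnergy_hasDerivAt {m e ω k : ℝ} (he : 0 < e) (hk : 0 < k) :
    HasDerivAt (profileEnergy m e ω)
      (m * e / 2 * k ^ (e - 1) * (ω - k + m ^ 2 / 4 * k ^ (2 * e))) k := by
  have h1 : HasDerivAt (fun k : ℝ => k ^ e) (e * k ^ (e - 1)) k :=
    Real.hasDerivAt_rpow_const (Or.inl hk.ne')
  have h2 : HasDerivAt (fun k : ℝ => k ^ (2 * e)) (2 * e * k ^ (2 * e - 1)) k :=
    Real.hasDerivAt_rpow_const (Or.inl hk.ne')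
  have h := (h1.const_mul (m / 2)).fun_mul
    ((((hasDerivAt_id k).const_mul (e / (e + 1))).const_sub ω).fun_add
      (h2.const_mul (m ^ 2 / 12)))
  refine h.congr_deriv ?_
  rw [Real.rpow_sub_one hk.ne', Real.rpow_sub_one hk.ne']
  simp only [id]
  field_simp
  ring

lemma continuousOn_profileEnergy {m e ω : ℝ} (he : 0 < e) :
    ContinuousOn (profileEnergy m e ω) (Ici 0) := by
  have h1 : Continuous fun k : ℝ => k ^ e := Real.continuous_rpow_const he.le
  have h2 : Continuous fun k : ℝ => k ^ (2 * e) := Real.continuous_rpow_const (by linarith)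
  unfold profileEnergy
  fun_prop

lemma profileEnergy_zero {m e ω : ℝ} (he : 0 < e) : profileEnergy m e ω 0 = 0 := by
  simp [profileEnergy, Real.zero_rpow he.ne']

/-- The function `A k - B k ^ q` of `k > 0` has its strict maximum at the critical point `κ`. -/
lemma sub_rpow_lt {A B q k κ : ℝ} (hB : 0 < B) (hq : 1 < q) (hk : 0 < k) (hκ : 0 < κ)
    (hcrit : q * B * κ ^ (q - 1) = A) (hne : k ≠ κ) : A * k - B * k ^ q < A * κ - B * κ ^ q := by
  have h := rpow_tangent_lt (e := q - 1) (by linarith) hk hκ hne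
  have h2 := mul_lt_mul_of_pos_left h (show 0 < q * B by positivity)
  have hq0 : q ≠ 0 := by linarith
  have e1 : ∀ x : ℝ, 0 < x → x ^ q = x * x ^ (q - 1) := fun x hx => by
    rw [Real.rpow_sub_one hx.ne']; field_simp
  rw [sub_add_cancel, ← e1 k hk, ← e1 κ hκ] at h2
  have e2 : q * B * (1 / q * κ ^ q - κ ^ q) = B * κ ^ q - A * κ := by
    rw [← hcrit, e1 κ hκ]; field_simp
  have e3 : q * B * (1 / q * k ^ q - k * κ ^ (q - 1)) = B * k ^ q - A * k := by
    rw [← hcrit]; field_simp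
  linarith

lemma sub_rpow_le {A B q k κ : ℝ} (hB : 0 < B) (hq : 1 < q) (hk : 0 < k) (hκ : 0 < κ)
    (hcrit : q * B * κ ^ (q - 1) = A) : A * k - B * k ^ q ≤ A * κ - B * κ ^ q := by
  rcases eq_or_ne k κ with rfl | hne
  · exact le_rfl
  · exact (sub_rpow_lt hB hq hk hκ hcrit hne).le

/-- If the strictly convex function `ω - k + b k ^ q` is positive at `0` and negative somewhere, it
has exactly two zeros, and is negative exactly between them. -/
lemma exists_two_zeros {b q ω κ : ℝ} (hb : 0 < b) (hq : 1 < q) (hω : 0 < ω) (hκ : 0 < κ)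
    (hneg : ω - κ + b * κ ^ q < 0) :
    ∃ k₁ k₂ : ℝ, 0 < k₁ ∧ k₁ < k₂ ∧ ω - k₁ + b * k₁ ^ q = 0 ∧ ω - k₂ + b * k₂ ^ q = 0 ∧
      (∀ x, 0 ≤ x → x < k₁ → 0 < ω - x + b * x ^ q) ∧
      (∀ x, k₁ < x → x < k₂ → ω - x + b * x ^ q < 0) ∧
      ∀ x, k₂ < x → 0 < ω - x + b * x ^ q := by
  let G : ℝ → ℝ := fun x => ω - x + b * x ^ q
  have hq0 : 0 < q := by linarith
  have hG : Continuous G := by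
    have := Real.continuous_rpow_const hq0.le
    fun_prop
  have hconv : StrictConvexOn ℝ (Ici 0) G := by
    have h1 : StrictConvexOn ℝ (Ici (0 : ℝ)) fun x : ℝ => b * x ^ q := by
      refine ⟨convex_Ici 0, fun x hx y hy hxy s t hs ht hst => ?_⟩
      have := mul_lt_mul_of_pos_left ((strictConvexOn_rpow hq).2 hx hy hxy hs ht hst) hb
      simp only [smul_eq_mul] at this ⊢
      linarith
    refine ⟨convex_Ici 0, fun x hx y hy hxy s t hs ht hst => ?_⟩
    have := h1.2 hx hy hxy hs ht hst
    simp only [smul_eq_mul, G] at this ⊢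
    have e : s * ω + t * ω = ω := by rw [← add_mul, hst, one_mul]
    linarith
  have hG0 : 0 < G 0 := by simpa [G, Real.zero_rpow hq0.ne'] using hω
  -- a point beyond which `b k ^ q` dominates `k`
  have hKex : ∃ K, κ < K ∧ 0 < G K := by
    let y : ℝ := b⁻¹ ^ (q - 1)⁻¹
    have hy : 0 < y := Real.rpow_pos_of_pos (inv_pos.2 hb) _
    have hyq : y ^ (q - 1) = b⁻¹ := by
      rw [← Real.rpow_mul (inv_pos.2 hb).le, inv_mul_cancel₀ (by linarith), Real.rpow_one]
    have hx0 : 0 < max (κ + 1) y := lt_max_of_lt_right hy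
    refine ⟨max (κ + 1) y, (lt_add_one κ).trans_le (le_max_left _ _), ?_⟩
    have h1 : b⁻¹ ≤ (max (κ + 1) y) ^ (q - 1) := by
      rw [← hyq]; exact Real.rpow_le_rpow hy.le (le_max_right _ _) (by linarith)
    have h2 : 1 ≤ b * (max (κ + 1) y) ^ (q - 1) := by
      have := mul_le_mul_of_nonneg_left h1 hb.le
      rwa [mul_inv_cancel₀ hb.ne'] at this
    have h3 : (max (κ + 1) y) ^ q = (max (κ + 1) y) ^ (q - 1) * max (κ + 1) y := by
      rw [Real.rpow_sub_one hx0.ne']; field_simp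
    simp only [G, h3]
    nlinarith
  obtain ⟨K, hκK, hGK⟩ := hKex
  obtain ⟨k₁, ⟨hk₁0, hk₁κ⟩, hk₁⟩ :=
    intermediate_value_Ioo' hκ.le hG.continuousOn (⟨hneg, hG0⟩ : (0 : ℝ) ∈ Ioo (G κ) (G 0))
  obtain ⟨k₂, ⟨hκk₂, -⟩, hk₂⟩ :=
    intermediate_value_Ioo hκK.le hG.continuousOn (⟨hneg, hGK⟩ : (0 : ℝ) ∈ Ioo (G κ) (G K))
  have hseg : ∀ x y z, 0 ≤ x → x < y → y < z → G y < max (G x) (G z) := fun x y z hx hxy hyz =>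
    hconv.lt_on_openSegment hx (hx.trans (hxy.trans hyz).le) (hxy.trans hyz).ne
      (by rw [openSegment_eq_Ioo (hxy.trans hyz)]; exact ⟨hxy, hyz⟩)
  refine ⟨k₁, k₂, hk₁0, hk₁κ.trans hκk₂, hk₁, hk₂, fun x hx hxk => ?_, fun x h1 h2 => ?_,
    fun x hxk => ?_⟩
  · by_contra hcon
    have := hseg x k₁ κ hx hxk hk₁κ
    rw [hk₁] at this
    exact this.not_ge (max_le (not_lt.1 hcon) hneg.le)
  · have := hseg k₁ x k₂ hk₁0.le h1 h2
    rwa [hk₁, hk₂, max_self] at this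
  · by_contra hcon
    have := hseg κ k₂ x hκ.le hκk₂ hxk
    rw [hk₂] at this
    exact this.not_ge (max_le hneg.le (not_lt.1 hcon))

/-- The energy of the profiles increases up to the first root, decreases between the roots and
increases after the second one. -/
lemma exists_roots_profileEnergy {m e ω κ : ℝ} (hm : 0 < m) (he : 1 / 2 < e) (hω : 0 < ω)
    (hκ : 0 < κ) (hneg : ω - κ + m ^ 2 / 4 * κ ^ (2 * e) < 0) :
    ∃ k₁ k₂ : ℝ, 0 < k₁ ∧ k₁ < k₂ ∧
      {k : ℝ | 0 < k ∧ k = ω + 1 / 4 * m ^ 2 * k ^ (2 * e)} = {k₁, k₂} ∧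
      profileEnergy m e ω k₂ < profileEnergy m e ω k₁ ∧
      (∀ k, 0 < k → k ≤ k₁ → 0 ≤ profileEnergy m e ω k) ∧
      ∀ k, k₁ ≤ k → profileEnergy m e ω k₂ ≤ profileEnergy m e ω k := by
  have he0 : 0 < e := by linarith
  obtain ⟨k₁, k₂, hk₁, hk₁₂, hz₁, hz₂, hs₁, hs₂, hs₃⟩ :=
    exists_two_zeros (b := m ^ 2 / 4) (by positivity) (by linarith) hω hκ hneg
  have hcont := continuousOn_profileEnergy (m := m) (ω := ω) he0
  have hfac : ∀ k : ℝ, 0 < k → 0 < m * e / 2 * k ^ (e - 1) := fun k hk => by positivity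
  have hm₁ : StrictMonoOn (profileEnergy m e ω) (Icc 0 k₁) := by
    refine strictMonoOn_of_deriv_pos (convex_Icc _ _) (hcont.mono Icc_subset_Ici_self) ?_
    rw [interior_Icc]
    intro x hx
    rw [(profileEnergy_hasDerivAt he0 hx.1).deriv]
    exact mul_pos (hfac x hx.1) (hs₁ x hx.1.le hx.2)
  have hm₂ : StrictAntiOn (profileEnergy m e ω) (Icc k₁ k₂) := by
    refine strictAntiOn_of_deriv_neg (convex_Icc _ _)
      (hcont.mono fun x hx => hk₁.le.trans hx.1) ?_
    rw [interior_Icc]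
    intro x hx
    have hx0 := hk₁.trans hx.1
    rw [(profileEnergy_hasDerivAt he0 hx0).deriv]
    exact mul_neg_of_pos_of_neg (hfac x hx0) (hs₂ x hx.1 hx.2)
  have hm₃ : StrictMonoOn (profileEnergy m e ω) (Ici k₂) := by
    have hk₂ := hk₁.trans hk₁₂
    refine strictMonoOn_of_deriv_pos (convex_Ici _) (hcont.mono (Ici_subset_Ici.2 hk₂.le)) ?_
    rw [interior_Ici]
    intro x hx
    have hx0 := hk₂.trans hx
    rw [(profileEnergy_hasDerivAt he0 hx0).deriv]
    exact mul_pos (hfac x hx0) (hs₃ x hx)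
  refine ⟨k₁, k₂, hk₁, hk₁₂, ?_, hm₂ ⟨le_rfl, hk₁₂.le⟩ ⟨hk₁₂.le, le_rfl⟩ hk₁₂, ?_, ?_⟩
  · ext k
    simp only [mem_ofPred_eq, mem_insert_iff, mem_singleton_iff]
    constructor
    · rintro ⟨hk, hkeq⟩
      have h0 : ω - k + m ^ 2 / 4 * k ^ (2 * e) = 0 := by linarith
      by_contra hne
      push Not at hne
      rcases lt_or_gt_of_ne hne.1 with h | h
      · exact (hs₁ k hk.le h).ne' h0
      · rcases lt_or_gt_of_ne hne.2 with h' | h'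
        · exact (hs₂ k h h').ne h0
        · exact (hs₃ k h').ne' h0
    · rintro (rfl | rfl)
      · exact ⟨hk₁, by linarith⟩
      · exact ⟨hk₁.trans hk₁₂, by linarith⟩
  · intro k hk hkk
    rw [← profileEnergy_zero (m := m) (ω := ω) he0]
    exact hm₁.monotoneOn ⟨le_rfl, hk₁.le⟩ ⟨hk.le, hkk⟩ hk.le
  · intro k hk
    rcases le_total k k₂ with h | h
    · exact hm₂.antitoneOn ⟨hk, h⟩ ⟨hk₁₂.le, le_rfl⟩ h
    · exact hm₃.monotoneOn self_mem_Ici h h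

/-! ### The thresholds -/

/-- The frequency of the profile with zero energy at the threshold `ω₀`: the critical point of
`(e / (e + 1)) k - (m² / 12) k ^ (2 e)`. -/
noncomputable def kappa0 (p : ℝ) : ℝ :=
  ((m p ^ 2 * (3 + p) / (p - 1)) / 12) ^ (-((p - 1) / (2 * (3 - p))))

/-- The critical point of `k - (m² / 4) k ^ (2 e)`, whose maximum is `ω₁`. -/
noncomputable def kappa1 (p : ℝ) : ℝ :=
  ((5 - p) * m p ^ 2 / (4 * (p - 1))) ^ (-((p - 1) / (2 * (3 - p))))

lemma kappa0_pos {p : ℝ} (hp1 : 1 < p) : 0 < kappa0 p := by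
  have := m_pos hp1
  have : 0 < p - 1 := by linarith
  exact Real.rpow_pos_of_pos (by positivity) _

lemma kappa1_pos {p : ℝ} (hp1 : 1 < p) (hp3 : p < 3) : 0 < kappa1 p := by
  have := m_pos hp1
  have : 0 < p - 1 := by linarith
  have : 0 < 5 - p := by linarith
  exact Real.rpow_pos_of_pos (by positivity) _

lemma neg_exponent_mul {p : ℝ} (hp1 : 1 < p) (hp3 : p < 3) :
    -((p - 1) / (2 * (3 - p))) * (2 * massExp p - 1) = -1 := by
  rw [two_mul_massExp hp1]
  have : p - 1 ≠ 0 := by linarith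
  have : 3 - p ≠ 0 := by linarith
  field_simp
  ring

lemma kappa0_rpow {p : ℝ} (hp1 : 1 < p) (hp3 : p < 3) :
    kappa0 p ^ (2 * massExp p - 1) = 12 * (p - 1) / (m p ^ 2 * (3 + p)) := by
  have := m_pos hp1
  have : 0 < p - 1 := by linarith
  rw [kappa0, ← Real.rpow_mul (by positivity), neg_exponent_mul hp1 hp3, Real.rpow_neg_one]
  field_simp

lemma kappa1_rpow {p : ℝ} (hp1 : 1 < p) (hp3 : p < 3) :
    kappa1 p ^ (2 * massExp p - 1) = 4 * (p - 1) / ((5 - p) * m p ^ 2) := by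
  have := m_pos hp1
  have : 0 < p - 1 := by linarith
  have : 0 < 5 - p := by linarith
  rw [kappa1, ← Real.rpow_mul (by positivity), neg_exponent_mul hp1 hp3, Real.rpow_neg_one]
  field_simp

lemma omega1_eq {p : ℝ} (hp1 : 1 < p) (hp3 : p < 3) :
    omega1 p = 1 * kappa1 p - m p ^ 2 / 4 * kappa1 p ^ (2 * massExp p) := by
  have := m_pos hp1
  have : 0 < p - 1 := by linarith
  have : 0 < 5 - p := by linarith
  have : 3 - p ≠ 0 := by linarith
  have e : -((5 - p) / (2 * (3 - p))) = -((p - 1) / (2 * (3 - p))) * (2 * massExp p) := by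
    rw [two_mul_massExp hp1]; field_simp
  rw [omega1, e, Real.rpow_mul (by positivity), one_mul]
  rfl

/-- The maximal value of `(e / (e + 1)) k - (m² / 12) k ^ (2 e)`. -/
lemma energy_max_eq {p : ℝ} (hp1 : 1 < p) (hp3 : p < 3)
    :
    massExp p / (massExp p + 1) * kappa0 p - m p ^ 2 / 12 * kappa0 p ^ (2 * massExp p)
      = 2 * (3 - p) / (3 + p) * kappa0 p := by
  have hκ := kappa0_pos hp1
  have hm := m_pos hp1
  have : 0 < p - 1 := by linarith
  have h : kappa0 p ^ (2 * massExp p) = kappa0 p ^ (2 * massExp p - 1) * kappa0 p := by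
    rw [Real.rpow_sub_one hκ.ne']; field_simp
  have e1 : massExp p + 1 = (3 + p) / (2 * (p - 1)) := by
    unfold massExp; field_simp; ring
  have e2 : massExp p = (5 - p) / (2 * (p - 1)) := by
    unfold massExp; field_simp; ring
  rw [h, kappa0_rpow hp1 hp3, e1, e2]
  field_simp
  ring

lemma energy_max_eq_omega0_formula {p : ℝ} (hp1 : 1 < p) (hp3 : p < 3)
    :
    2 * (3 - p) / (3 + p) * kappa0 p =
      (3 - p) / (3 + p) * (3 : ℝ) ^ ((p - 1) / (2 * (3 - p))) * (2 : ℝ) ^ (2 / (3 - p)) *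
        (m p ^ 2 * (3 + p) / (p - 1)) ^ (-((p - 1) / (2 * (3 - p)))) := by
  have hm := m_pos hp1
  have : 0 < p - 1 := by linarith
  have h3 : 3 - p ≠ 0 := by linarith
  have e : (2 : ℝ) / (3 - p) = 1 + 2 * ((p - 1) / (2 * (3 - p))) := by field_simp; ring
  rw [kappa0, e, Real.rpow_add two_pos, Real.rpow_one, Real.rpow_mul zero_le_two, Real.rpow_two,
    div_eq_mul_inv (m p ^ 2 * (3 + p) / (p - 1)) 12,
    Real.mul_rpow (by positivity) (by norm_num), Real.inv_rpow (by norm_num),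
    Real.rpow_neg (by norm_num) (x := (12 : ℝ)), inv_inv,
    show (12 : ℝ) = 3 * 2 ^ 2 by norm_num, Real.mul_rpow (by norm_num) (by norm_num)]
  ring

/-- Both thresholds are values of `k - (m² / 4) k ^ (2 e)`, at `κ₀` and at its maximum `κ₁`. -/
lemma energy_max_lt_omega1 {p : ℝ} (hp1 : 1 < p) (hp3 : p < 3) :
    2 * (3 - p) / (3 + p) * kappa0 p < omega1 p := by
  have hκ := kappa0_pos hp1
  have hm := m_pos hp1
  have hpp : 0 < p - 1 := by linarith
  have hp5 : 0 < 5 - p := by linarith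
  have he := half_lt_massExp hp1 hp3
  have hcrit : 2 * massExp p * (m p ^ 2 / 4) * kappa1 p ^ (2 * massExp p - 1) = 1 := by
    rw [kappa1_rpow hp1 hp3, two_mul_massExp hp1]
    field_simp
  have hne : kappa0 p ≠ kappa1 p := by
    intro h
    have h0 := kappa0_rpow hp1 hp3
    rw [h, kappa1_rpow hp1 hp3] at h0
    field_simp at h0
    linarith
  have hlt := sub_rpow_lt (show 0 < m p ^ 2 / 4 by positivity) (by linarith) hκ
    (kappa1_pos hp1 hp3) hcrit hne
  rw [omega1_eq hp1 hp3]
  refine lt_of_eq_of_lt ?_ hlt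
  have h : kappa0 p ^ (2 * massExp p) = kappa0 p ^ (2 * massExp p - 1) * kappa0 p := by
    rw [Real.rpow_sub_one hκ.ne']; field_simp
  rw [h, kappa0_rpow hp1 hp3]
  field_simp
  ring

/-- `J_ω` takes a negative value exactly below the maximum of
`(e / (e + 1)) k - (m² / 12) k ^ (2 e)`. -/
lemma exists_J_neg_iff {p : ℝ} (hp1 : 1 < p) (hp3 : p < 3) (ω : ℝ) :
    (∃ u ∈ H1, J p ω u < 0) ↔ ω < 2 * (3 - p) / (3 + p) * kappa0 p := by
  have hκ := kappa0_pos hp1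
  have hm := m_pos hp1
  have hpp : 0 < p - 1 := by linarith
  have he := half_lt_massExp hp1 hp3
  have hmax := energy_max_eq hp1 hp3
  constructor
  · rintro ⟨u, hu, hneg⟩
    rcases J_eq_zero_or_exists_J_w_le (ω := ω) hp1 (by linarith) hu with h | ⟨k, hk, h⟩
    · exact absurd h hneg.ne
    · have hlt := h.trans_lt hneg
      rw [J_w_eq_profileEnergy hp1 hk, profileEnergy] at hlt
      have hb := neg_of_mul_neg_right hlt (by positivity)
      have hcrit : 2 * massExp p * (m p ^ 2 / 12) * kappa0 p ^ (2 * massExp p - 1)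
          = massExp p / (massExp p + 1) := by
        have e1 : massExp p + 1 = (3 + p) / (2 * (p - 1)) := by
          unfold massExp; field_simp; ring
        rw [kappa0_rpow hp1 hp3, e1]
        field_simp
      have := sub_rpow_le (show 0 < m p ^ 2 / 12 by positivity) (by linarith) hk hκ hcrit
      linarith
  · intro hω
    refine ⟨w p (kappa0 p), w_mem_H1 hp1 hκ, ?_⟩
    rw [J_w_eq_profileEnergy hp1 hκ, profileEnergy]
    refine mul_neg_of_pos_of_neg (by positivity) ?_
    linarith

lemma energy_max_pos {p : ℝ} (hp1 : 1 < p) (hp3 : p < 3) :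
    0 < 2 * (3 - p) / (3 + p) * kappa0 p :=
  mul_pos (div_pos (by linarith) (by linarith)) (kappa0_pos hp1)

lemma omega0_eq {p : ℝ} (hp1 : 1 < p) (hp3 : p < 3) :
    omega0 p = 2 * (3 - p) / (3 + p) * kappa0 p := by
  have hzero : (0 : ℝ → ℝ) ∈ H1 :=
    ⟨MemLp.zero, 0, MemLp.zero, (isPrimitive_of_hasDerivAt (fun x => hasDerivAt_const x 0)
      continuous_const).isWeakDeriv⟩
  have hw : weakDeriv (0 : ℝ → ℝ) =ᵐ[volume] 0 :=
    weakDeriv_ae_eq MemLp.zero (isPrimitive_of_hasDerivAt (fun x => hasDerivAt_const x 0)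
      continuous_const).isWeakDeriv
  have hJ0 : ∀ ω, J p ω 0 = 0 := by
    intro ω
    have : ∫ r, (|weakDeriv (0 : ℝ → ℝ) r| ^ 2 + ω * (0 : ℝ → ℝ) r ^ 2) = ∫ _ : ℝ, (0 : ℝ) :=
      integral_congr_ae (hw.mono fun x hx => by simp [hx])
    rw [J, this]
    simp [Real.zero_rpow (show p + 1 ≠ 0 by linarith)]
  have hset : {ω : ℝ | 0 ≤ ω ∧ IsLeast (J p ω '' H1) 0}
      = Ici (2 * (3 - p) / (3 + p) * kappa0 p) := by
    ext ω
    have hiff := not_congr (exists_J_neg_iff hp1 hp3 ω)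
    push Not at hiff
    rw [mem_Ici, ← hiff]
    constructor
    · exact fun h u hu => h.2.2 ⟨u, hu, rfl⟩
    · intro h
      refine ⟨(energy_max_pos hp1 hp3).le.trans (hiff.1 h), ⟨0, hzero, hJ0 ω⟩, ?_⟩
      rintro _ ⟨u, hu, rfl⟩
      exact h u hu
  rw [omega0, hset, csInf_Ici]

end GaugedNLS

theorem proposition3p4 (p : ℝ) (hp1 : 1 < p) (hp3 : p < 3) :
    -- `w_k` is the unique positive radial solution in `H¹(ℝ)` of `-w'' + k w = w ^ p`
    (∀ k : ℝ, 0 < k →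
      GaugedNLS.IsPositiveRadialSolution p k (GaugedNLS.w p k) ∧
      ∀ v : ℝ → ℝ, GaugedNLS.IsPositiveRadialSolution p k v → v = GaugedNLS.w p k) ∧
    -- `ω₀` is the threshold below which `J_ω` takes negative values
    (0 < GaugedNLS.omega0 p ∧
      ∀ ω : ℝ, 0 ≤ ω →
        ((∃ u ∈ GaugedNLS.H1, GaugedNLS.J p ω u < 0) ↔ ω < GaugedNLS.omega0 p)) ∧
    -- `ω₀ < ω₁`, and the explicit value of `ω₀`
    GaugedNLS.omega0 p < GaugedNLS.omega1 p ∧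
    GaugedNLS.omega0 p =
      (3 - p) / (3 + p) * (3 : ℝ) ^ ((p - 1) / (2 * (3 - p))) * (2 : ℝ) ^ (2 / (3 - p)) *
        (GaugedNLS.m p ^ 2 * (3 + p) / (p - 1)) ^ (-((p - 1) / (2 * (3 - p)))) ∧
    -- for `0 < ω < ω₁` there are exactly two roots `k₁ < k₂`, and `J_ω(w_{k₁}) > J_ω(w_{k₂})`;
    -- for `0 < ω < ω₀` the function `w_{k₂}` is a global minimizer of `J_ω`
    (∀ ω : ℝ, 0 < ω → ω < GaugedNLS.omega1 p →
      ∃ k₁ k₂ : ℝ, k₁ < k₂ ∧ GaugedNLS.roots p ω = {k₁, k₂} ∧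
        GaugedNLS.J p ω (GaugedNLS.w p k₂) < GaugedNLS.J p ω (GaugedNLS.w p k₁) ∧
        (ω < GaugedNLS.omega0 p →
          GaugedNLS.w p k₂ ∈ GaugedNLS.H1 ∧
          IsMinOn (GaugedNLS.J p ω) GaugedNLS.H1 (GaugedNLS.w p k₂))) := by
  have h0 := GaugedNLS.omega0_eq hp1 hp3
  refine ⟨fun k hk => ⟨GaugedNLS.isPositiveRadialSolution_w hp1 hk, fun v hv => hv.eq_w hp1 hk⟩,
    ⟨?_, fun ω _ => ?_⟩, ?_, ?_, fun ω hω hω1 => ?_⟩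
  · rw [h0]; exact GaugedNLS.energy_max_pos hp1 hp3
  · rw [h0]; exact GaugedNLS.exists_J_neg_iff hp1 hp3 ω
  · rw [h0]; exact GaugedNLS.energy_max_lt_omega1 hp1 hp3
  · rw [h0]; exact GaugedNLS.energy_max_eq_omega0_formula hp1 hp3
  · rw [GaugedNLS.omega1_eq hp1 hp3] at hω1
    obtain ⟨k₁, k₂, hk₁, hk₁₂, hroots, hlt, hpos, hmin⟩ :=
      GaugedNLS.exists_roots_profileEnergy (GaugedNLS.m_pos hp1)
        (GaugedNLS.half_lt_massExp hp1 hp3) hω (GaugedNLS.kappa1_pos hp1 hp3) (by linarith)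
    have hk₂ := hk₁.trans hk₁₂
    refine ⟨k₁, k₂, hk₁₂, ?_, ?_, fun hω0 => ⟨GaugedNLS.w_mem_H1 hp1 hk₂, ?_⟩⟩
    · rw [← hroots, GaugedNLS.two_mul_massExp hp1]; rfl
    · rw [GaugedNLS.J_w_eq_profileEnergy hp1 hk₁, GaugedNLS.J_w_eq_profileEnergy hp1 hk₂]
      exact hlt
    · rw [h0, ← GaugedNLS.exists_J_neg_iff hp1 hp3 ω] at hω0
      -- a profile of negative energy lies beyond the first root
      have hbound : ∀ κ, 0 < κ → GaugedNLS.J p ω (GaugedNLS.w p κ) < 0 →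
          GaugedNLS.J p ω (GaugedNLS.w p k₂) ≤ GaugedNLS.J p ω (GaugedNLS.w p κ) := by
        intro κ hκ hneg
        rw [GaugedNLS.J_w_eq_profileEnergy hp1 hκ] at hneg ⊢
        rw [GaugedNLS.J_w_eq_profileEnergy hp1 hk₂]
        refine hmin κ ?_
        by_contra hcon
        exact (hpos κ hκ (not_le.1 hcon).le).not_gt hneg
      have hneg₂ : GaugedNLS.J p ω (GaugedNLS.w p k₂) < 0 := by
        obtain ⟨u, hu, hneg⟩ := hω0
        rcases GaugedNLS.J_eq_zero_or_exists_J_w_le (ω := ω) hp1 (by linarith) hu with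
          h | ⟨κ, hκ, h⟩
        · exact absurd h hneg.ne
        · exact (hbound κ hκ (h.trans_lt hneg)).trans_lt (h.trans_lt hneg)
      refine isMinOn_iff.2 fun u hu => ?_
      rcases GaugedNLS.J_eq_zero_or_exists_J_w_le (ω := ω) hp1 (by linarith) hu with
        h | ⟨κ, hκ, h⟩
      · rw [h]; exact hneg₂.le
      · rcases lt_or_ge (GaugedNLS.J p ω (GaugedNLS.w p κ)) 0 with hn | hn
        · exact (hbound κ hκ hn).trans h
        · exact hneg₂.le.trans (hn.trans h)
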